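/- Let $k \ge 1$ be fixed. An instance of the $k$-objective maximum weighted satisfiability problem ($k$-MaxSAT) consists of a finite set $V$ of variables and a formula $H$ in conjunctive normal form over $V$, given as a finite list of clauses, each of which has a weight $w(C) \in \mathbb{N}^k$. Its solutions are the truth assignments $I \colon V \to \{0,1\}$, and the weight of $I$ is $$w(I) = (w_1(I), \dots, w_k(I)) = \sum_{C \in H,\ I(C) = 1} w(C) \in \mathbb{N}^k .$$ Instances are encoded by listing the variables and the clauses, with the components of the weights written in binary. A set $T$ of truth assignments is a $\tfrac12$-approximate Pareto set of the instance if for every truth assignment $I$ there is some $I' \in T$ such that $w_i(I') \ge \tfrac12\, w_i(I)$ for all $i \in \{1, \dots, k\}$. Theorem. For every $k \ge 1$, $k$-MaxSAT is $\tfrac12$-approximable: there is a deterministic algorithm that, for every instance of $k$-MaxSAT, outputs a $\tfrac12$-approximate Pareto set of the instance, in time polynomial in the length of the encoding of the instance. -/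

import Mathlib

/-! ### Multiobjective maximization problems and their approximation -/

/-- A `k`-objective maximization problem: instances, the solutions of each instance, and the weight
in `ℕ^k` of each solution, together with the encodings under which instances and solutions are
handled by a machine. Instances are words over a finite alphabet, solutions are words over
`{0, 1}`; different instances, and different solutions of one instance, have different codes. -/
structure MaxProblem (k : ℕ) where
  Instance : Type
  Solution : Instance → Type
  weight : (x : Instance) → Solution x → Fin k → ℕ
  Symbol : Type
  symbolFintype : Fintype Symbol
  encode : Instance → List Symbol
  encode_injective : Function.Injective encode
  encodeSolution : (x : Instance) → Solution x → List Bool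
  encodeSolution_injective : ∀ x, Function.Injective (encodeSolution x)

namespace MaxProblem

variable {k : ℕ}

/-- The solution `s` of `x` is `α`-approximated by the solution `s'` of `x`. -/
def ApproximatedBy (P : MaxProblem k) (α : ℝ) (x : P.Instance) (s s' : P.Solution x) : Prop :=
  ∀ i : Fin k, α * (P.weight x s i : ℝ) ≤ (P.weight x s' i : ℝ)

/-- `T` is an `α`-approximate Pareto set of `x`: every solution of `x` is `α`-approximated by some
solution in `T`. -/
def IsApproxParetoSet (P : MaxProblem k) (α : ℝ) (x : P.Instance) (T : Set (P.Solution x)) : Prop :=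
  ∀ s : P.Solution x, ∃ s' ∈ T, P.ApproximatedBy α x s s'

/-- A finite list of words over `{0, 1}` as a single word over the alphabet `{0, 1, none}`, where
the symbol `none` terminates each word of the list. -/
def encodeWords (L : List (List Bool)) : List (Option Bool) :=
  L.flatMap fun u => u.map some ++ [none]

theorem encodeWords_injective : Function.Injective encodeWords := by
  have key : ∀ (u u' : List Bool) (s s' : List (Option Bool)),
      u.map some ++ none :: s = u'.map some ++ none :: s' → u = u' ∧ s = s' := by
    intro u
    induction u with
    | nil => intro u' s s' h; cases u' <;> simp_all
    | cons b u ih =>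
      intro u' s s' h
      cases u' with
      | nil => simp at h
      | cons b' u' =>
        simp only [List.map_cons, List.cons_append, List.cons.injEq, Option.some.injEq] at h
        obtain ⟨h1, h2⟩ := ih u' s s' h.2
        exact ⟨by rw [h.1, h1], h2⟩
  intro L
  induction L with
  | nil => intro L' h; cases L' <;> simp_all [encodeWords]
  | cons u L ih =>
    intro L' h
    cases L' with
    | nil => simp [encodeWords] at h
    | cons u' L' =>
      simp only [encodeWords, List.flatMap_cons, List.append_assoc, List.cons_append,
        List.nil_append] at h
      obtain ⟨h1, h2⟩ := key _ _ _ _ h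
      rw [h1, ih h2]

/-- `P` is (deterministically) `α`-approximable: there is a deterministic Turing machine which, on
the code of an instance `x`, halts within a number of steps that is bounded by a polynomial in the
length of that code, and whose output is (the code of) a list of solutions of `x` that form an
`α`-approximate Pareto set of `x`. -/
def IsApproximable (P : MaxProblem k) (α : ℝ) : Prop :=
  ∃ A : (x : P.Instance) → List (P.Solution x),
    Nonempty (Turing.TM2ComputableInPolyTime P.encode encodeWords
      (fun x => (A x).map (P.encodeSolution x))) ∧
    ∀ x : P.Instance, P.IsApproxParetoSet α x {s | s ∈ A x}

end MaxProblem

/-! ### Weighted formulas in conjunctive normal form -/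

namespace MaxSAT

/-- A literal over the variables `v_0, …, v_{n-1}`: the pair `(v, true)` is the variable `v` itself
and `(v, false)` is its negation. -/
abbrev Literal (n : ℕ) : Type := Fin n × Bool

/-- A clause over `n` variables (the disjunction of a finite list of literals) with its weight in
`ℕ^k`. -/
structure WeightedClause (n k : ℕ) where
  literals : List (Literal n)
  weight : Fin k → ℕ

/-- A formula in CNF (the conjunction of a finite list of clauses) over a set of `numVars`
variables, where each clause has a weight in `ℕ^k`. -/
structure WeightedCNF (k : ℕ) where
  numVars : ℕ
  clauses : List (WeightedClause numVars k)

/-- The clause `C` is satisfied by the truth assignment `I`: some literal of `C` is true. -/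
def WeightedClause.IsSatisfiedBy {n k : ℕ} (C : WeightedClause n k) (I : Fin n → Bool) : Prop :=
  ∃ l ∈ C.literals, I l.1 = l.2

instance {n k : ℕ} (C : WeightedClause n k) (I : Fin n → Bool) : Decidable (C.IsSatisfiedBy I) :=
  inferInstanceAs (Decidable (∃ l ∈ C.literals, I l.1 = l.2))

/-- The `i`-th weight of a truth assignment `I`: the sum of the `i`-th weights of all clauses that
are satisfied by `I`. -/
def WeightedCNF.weight {k : ℕ} (x : WeightedCNF k) (I : Fin x.numVars → Bool) (i : Fin k) : ℕ :=
  ((x.clauses.filter fun C => C.IsSatisfiedBy I).map fun C => C.weight i).sum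

/-! ### Encoding of weighted formulas -/

/-- The input alphabet: two binary digits and five markers. -/
inductive Symbol where
  | var
  | clause
  | literal (sign : Bool)
  | weight
  | bit (b : Bool)
  deriving DecidableEq, Fintype

/-- A natural number in binary. -/
def encodeNat (m : ℕ) : List Symbol :=
  (Computability.encodeNat m).map Symbol.bit

/-- A literal: a marker for its sign, followed by the index of its variable in binary. -/
def encodeLiteral {n : ℕ} (l : Literal n) : List Symbol :=
  Symbol.literal l.2 :: encodeNat l.1

/-- A component of a weight vector: a marker, followed by the number in binary. -/
def encodeWeight (m : ℕ) : List Symbol :=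
  Symbol.weight :: encodeNat m

/-- A weighted clause: a marker, followed by its literals and by the components of its weight. -/
def WeightedClause.encode {n k : ℕ} (C : WeightedClause n k) : List Symbol :=
  Symbol.clause :: (C.literals.flatMap encodeLiteral ++ (List.ofFn C.weight).flatMap encodeWeight)

/-- A weighted formula: the list of its variables (one marker for each of them), followed by its
weighted clauses. -/
def WeightedCNF.encode {k : ℕ} (x : WeightedCNF k) : List Symbol :=
  List.replicate x.numVars Symbol.var ++ x.clauses.flatMap WeightedClause.encode

theorem split_unique {β : Type} (p : β → Prop) : ∀ {a a' b b' : List β},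
    (∀ s ∈ a, ¬ p s) → (∀ s ∈ a', ¬ p s) → (∀ s ∈ b.head?, p s) → (∀ s ∈ b'.head?, p s) →
    a ++ b = a' ++ b' → a = a' ∧ b = b'
  | [], [], _, _, _, _, _, _, h => ⟨rfl, h⟩
  | [], s :: _, _, _, _, ha', hb, _, h => by
      simp only [List.nil_append, List.cons_append] at h
      subst h
      exact absurd (hb s rfl) (ha' s (by simp))
  | s :: _, [], _, _, ha, _, _, hb', h => by
      simp only [List.nil_append, List.cons_append] at h
      subst h
      exact absurd (hb' s rfl) (ha s (by simp))
  | s :: a, s' :: a', b, b', ha, ha', hb, hb', h => by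
      simp only [List.cons_append, List.cons.injEq] at h
      have := split_unique p (fun t ht => ha t (by simp [ht])) (fun t ht => ha' t (by simp [ht]))
        hb hb' h.2
      exact ⟨by rw [h.1, this.1], this.2⟩

theorem head_flatMap {α β : Type} (p : β → Prop) (f : α → List β)
    (hf : ∀ a, ∃ s t, f a = s :: t ∧ p s) (L : List α) : ∀ s ∈ (L.flatMap f).head?, p s := by
  cases L with
  | nil => simp
  | cons a L =>
    obtain ⟨s, t, h, hs⟩ := hf a
    simp [h, hs]

theorem flatMap_injective {α β : Type} (p : β → Prop) (f : α → List β)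
    (hf : Function.Injective f) (hp : ∀ a, ∃ s t, f a = s :: t ∧ p s ∧ ∀ r ∈ t, ¬ p r) :
    Function.Injective fun L : List α => L.flatMap f := by
  have hp' : ∀ a, ∃ s t, f a = s :: t ∧ p s := fun a => by
    obtain ⟨s, t, h, hs, _⟩ := hp a
    exact ⟨s, t, h, hs⟩
  intro L
  induction L with
  | nil =>
    intro L' h
    cases L' with
    | nil => rfl
    | cons a' L' =>
      obtain ⟨s, t, h', _⟩ := hp' a'
      simp [h'] at h
  | cons a L ih =>
    intro L' h
    cases L' with
    | nil =>
      obtain ⟨s, t, h', _⟩ := hp' a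
      simp [h'] at h
    | cons a' L' =>
      obtain ⟨s, t, e, hs, ht⟩ := hp a
      obtain ⟨s', t', e', hs', ht'⟩ := hp a'
      simp only [List.flatMap_cons, e, e', List.cons_append, List.cons.injEq] at h
      obtain ⟨h1, h2⟩ := split_unique p ht ht' (head_flatMap p f hp' L) (head_flatMap p f hp' L') h.2
      have haa : a = a' := hf (by rw [e, e', h.1, h1])
      rw [haa, ih h2]

theorem encodeNat_injective : Function.Injective encodeNat := by
  intro a b h
  have hb : Function.Injective Symbol.bit := fun _ _ h => by injection h
  have := List.map_injective_iff.2 hb h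
  rw [← Computability.decode_encodeNat a, this, Computability.decode_encodeNat]

theorem mem_encodeNat {m : ℕ} {s : Symbol} (h : s ∈ encodeNat m) : ∃ b, s = Symbol.bit b := by
  obtain ⟨b, _, rfl⟩ := List.mem_map.1 h
  exact ⟨b, rfl⟩

theorem encodeLiterals_injective {n : ℕ} :
    Function.Injective fun L : List (Literal n) => L.flatMap encodeLiteral := by
  apply flatMap_injective fun s => ∃ b, s = Symbol.literal b
  · rintro ⟨v, b⟩ ⟨v', b'⟩ h
    simp only [encodeLiteral, List.cons.injEq, Symbol.literal.injEq] at h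
    rw [Prod.mk.injEq]
    exact ⟨Fin.ext (encodeNat_injective h.2), h.1⟩
  · intro l
    refine ⟨_, _, rfl, ⟨_, rfl⟩, fun r hr => ?_⟩
    obtain ⟨b, rfl⟩ := mem_encodeNat hr
    simp

theorem encodeWeights_injective :
    Function.Injective fun L : List ℕ => L.flatMap encodeWeight := by
  apply flatMap_injective fun s => s = Symbol.weight
  · intro m m' h
    simp only [encodeWeight, List.cons.injEq, true_and] at h
    exact encodeNat_injective h
  · intro m
    refine ⟨_, _, rfl, rfl, fun r hr => ?_⟩
    obtain ⟨b, rfl⟩ := mem_encodeNat hr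
    simp

theorem WeightedClause.encode_injective {n k : ℕ} :
    Function.Injective (WeightedClause.encode : WeightedClause n k → List Symbol) := by
  rintro ⟨L, w⟩ ⟨L', w'⟩ h
  have key : ∀ (L : List (Literal n)), ∀ s ∈ L.flatMap encodeLiteral, ¬ s = Symbol.weight := by
    rintro L s hs rfl
    obtain ⟨l, _, hl⟩ := List.mem_flatMap.1 hs
    simp [encodeLiteral, encodeNat] at hl
  have hd := head_flatMap (fun s => s = Symbol.weight) encodeWeight fun m => ⟨_, _, rfl, rfl⟩
  simp only [WeightedClause.encode, List.cons.injEq, true_and] at h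
  obtain ⟨h1, h2⟩ := split_unique (fun s => s = Symbol.weight) (key L) (key L') (hd _) (hd _) h
  have e1 := encodeLiterals_injective h1
  have e2 := List.ofFn_injective (encodeWeights_injective h2)
  rw [e1, e2]

theorem WeightedCNF.encode_injective {k : ℕ} :
    Function.Injective (WeightedCNF.encode : WeightedCNF k → List Symbol) := by
  rintro ⟨n, C⟩ ⟨n', C'⟩ h
  have key : ∀ m : ℕ, ∀ s ∈ List.replicate m Symbol.var, ¬ s = Symbol.clause := by
    rintro m s hs rfl
    simp at hs
  have hc : ∀ {m : ℕ} (D : WeightedClause m k), ∃ s t, D.encode = s :: t ∧ s = Symbol.clause ∧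
      ∀ r ∈ t, ¬ r = Symbol.clause := by
    intro m D
    refine ⟨_, _, rfl, rfl, ?_⟩
    rintro r hr rfl
    simp [encodeLiteral, encodeWeight, encodeNat] at hr
  have hd := fun {m : ℕ} => head_flatMap (fun s => s = Symbol.clause)
    (WeightedClause.encode : WeightedClause m k → List Symbol) fun D => ⟨_, _, rfl, rfl⟩
  obtain ⟨h1, h2⟩ := split_unique (fun s => s = Symbol.clause) (key n) (key n') (hd _) (hd _) h
  have hn : n = n' := by simpa using congrArg List.length h1
  subst hn
  have := flatMap_injective (fun s => s = Symbol.clause) WeightedClause.encode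
    WeightedClause.encode_injective hc h2
  exact congrArg (WeightedCNF.mk n) this

end MaxSAT

/-- The `k`-objective maximum weighted satisfiability problem. The solutions of an instance are the
truth assignments of its variables; a truth assignment is encoded by the list of its values. -/
def kMaxSAT (k : ℕ) : MaxProblem k where
  Instance := MaxSAT.WeightedCNF k
  Solution x := Fin x.numVars → Bool
  weight x I := x.weight I
  Symbol := MaxSAT.Symbol
  symbolFintype := inferInstance
  encode := MaxSAT.WeightedCNF.encode
  encode_injective := MaxSAT.WeightedCNF.encode_injective
  encodeSolution _ I := List.ofFn I
  encodeSolution_injective _ := List.ofFn_injective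

/-! For one objective, credit every clause to one of its literals and give each variable the value
with the larger credit: this yields half of the total weight. With `k` objectives the credits of `v`
and `¬v` are vectors, and all coordinates have to be balanced at once. Linear algebra does this up
to a bounded error: among coefficients in `[-1, 1]` that cancel the differences of these vectors,
some have at most `k` fractional entries, and rounding those to signs costs at most `k * N` per
coordinate if all credits are at most `N` (`exists_balanced_signs`).

The error is paid for by guessing. Fix a truth assignment `I`. A greedy choice (`exists_greedy`)
gives `k * (2 * (k + 1))` or fewer literals `G`, true under `I`, such that in objective `i` the
clauses satisfied by `G` weigh at least `2 * (k + 1) * g i`, where `g i` bounds the open weight of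
any single literal true under `I`. Heavier literals are false under `I` and can be fixed as such;
every undecided clause true under `I` then has a free literal, and is credited to the first one.

To find a balanced assignment, weights are rescaled so that a positive `g i` lies between `N / 2`
and `N`, where `N` exceeds the number of clauses. Rounding down loses less than `N` units in total
and balancing at most `k * N`; since `N` units are worth at most `2 * g i`, the loss is at most `2 *
(k + 1) * g i`, which the weight satisfied by `G` covers (`trueUnder_le`). The scaled vectors have
coordinates at most `N * N`, so they pack into one number of polynomial size, and a table indexed by
this number realizes every attainable vector. Running through all guesses of literals and scaling
exponents serves every `I`.

Polynomial time on a Turing machine comes from a small structured language that is compiled step by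
step (`Run.steps`). Data are binary trees on stacks; the class `PolyTime` is closed under
composition, pairing, case distinction and folds with polynomially bounded intermediate results.
Numbers are unary, which is affordable because only the original weights can be large, and those
stay lists of digits. -/

/-! ### Structured programs for machines with several stacks -/

namespace StackProgram

open Turing Function

/-- Structured programs over stacks `k : K` with alphabets `Γ k` and a finite memory `σ`. -/
inductive Cmd {K : Type} (Γ : K → Type) (σ : Type) : Type where
  | push (k : K) (f : σ → Γ k)
  | pop (k : K) (f : σ → Option (Γ k) → σ)
  | seq (a b : Cmd Γ σ)
  | switch (f : σ → Cmd Γ σ)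
  | loop (k : K) (f : σ → Option (Γ k) → σ) (p : σ → Bool) (body : Cmd Γ σ)

variable {K : Type} {Γ : K → Type} {σ : Type}

/-- Memory and stack contents of a program. -/
abbrev State (Γ : K → Type) (σ : Type) : Type := σ × (∀ k, List (Γ k))

/-- `Run c s t s'`: started in state `s`, the program `c` stops after `t` steps in state `s'`. -/
inductive Run [DecidableEq K] : Cmd Γ σ → State Γ σ → ℕ → State Γ σ → Prop
  | push (k f v S) : Run (.push k f) (v, S) 1 (v, update S k (f v :: S k))
  | pop (k f v S) : Run (.pop k f) (v, S) 1 (f v (S k).head?, update S k (S k).tail)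
  | seq {a b s t s' t' s''} : Run a s t s' → Run b s' t' s'' → Run (.seq a b) s (t + t') s''
  | switch {f v S t s'} : Run (f v) (v, S) t s' → Run (.switch f) (v, S) (1 + t) s'
  -- The test only peeks at the stack, so the body itself has to consume the tested symbol.
  | loop_done {k f p body v S} : p (f v (S k).head?) = false →
      Run (.loop k f p body) (v, S) 1 (f v (S k).head?, S)
  | loop_step {k f p body v S t s' t' s''} : p (f v (S k).head?) = true →
      Run body (f v (S k).head?, S) t s' → Run (.loop k f p body) s' t' s'' →
      Run (.loop k f p body) (v, S) (1 + (t + t')) s''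

namespace Cmd

/-- The labels used by the machine code of a program. -/
def Label : Cmd Γ σ → Type
  | push _ _ => Unit
  | pop _ _ => Unit
  | seq a b => a.Label ⊕ b.Label
  | switch f => Option (Σ v, (f v).Label)
  | loop _ _ _ body => Option body.Label

noncomputable instance instFintypeLabel [Fintype σ] : ∀ c : Cmd Γ σ, Fintype c.Label
  | push _ _ => inferInstanceAs (Fintype Unit)
  | pop _ _ => inferInstanceAs (Fintype Unit)
  | seq a b =>
    have := instFintypeLabel a
    have := instFintypeLabel b
    inferInstanceAs (Fintype (a.Label ⊕ b.Label))
  | switch f =>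
    have := fun v => instFintypeLabel (f v)
    inferInstanceAs (Fintype (Option (Σ v, (f v).Label)))
  | loop _ _ _ body =>
    have := instFintypeLabel body
    inferInstanceAs (Fintype (Option body.Label))

/-- The label at which a program starts. -/
def entry : (c : Cmd Γ σ) → c.Label
  | push _ _ => ()
  | pop _ _ => ()
  | seq a _ => Sum.inl a.entry
  | switch _ => (none : Option _)
  | loop _ _ _ _ => (none : Option _)

/-- The machine code of a program, for a given placement `e` of its labels and a given exit. -/
def code {Λ : Type} : (c : Cmd Γ σ) → (e : c.Label → Λ) → (exit : Λ) → c.Label → TM2.Stmt Γ Λ σ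
  | push k f, _, exit, _ => .push k f (.goto fun _ => exit)
  | pop k f, _, exit, _ => .pop k f (.goto fun _ => exit)
  | seq a b, e, _, Sum.inl l => a.code (fun l => e (Sum.inl l)) (e (Sum.inr b.entry)) l
  | seq _ b, e, exit, Sum.inr l => b.code (fun l => e (Sum.inr l)) exit l
  | switch f, e, _, none => .goto fun v => e (some ⟨v, (f v).entry⟩)
  | switch f, e, exit, some ⟨v, l⟩ => (f v).code (fun l => e (some ⟨v, l⟩)) exit l
  | loop k f p body, e, exit, none =>
    .peek k f (.branch p (.goto fun _ => e (some body.entry)) (.goto fun _ => exit))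
  | loop _ _ _ body, e, _, some l => body.code (fun l => e (some l)) (e none) l

end Cmd

/-- The machine `M` passes from the configuration `a` to the configuration `b` in `n` steps. -/
def Steps [DecidableEq K] {Λ : Type} (M : Λ → TM2.Stmt Γ Λ σ) (n : ℕ) (a b : TM2.Cfg Γ Λ σ) :
    Prop :=
  (flip bind (TM2.step M))^[n] (some a) = some b

theorem Steps.trans [DecidableEq K] {Λ : Type} {M : Λ → TM2.Stmt Γ Λ σ} {m n : ℕ}
    {a b c : TM2.Cfg Γ Λ σ} (h : Steps M m a b) (h' : Steps M n b c) : Steps M (m + n) a c := by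
  unfold Steps at *
  rw [Nat.add_comm, iterate_add_apply, h, h']

theorem Steps.single [DecidableEq K] {Λ : Type} {M : Λ → TM2.Stmt Γ Λ σ} {l : Λ} {v : σ}
    {S : ∀ k, List (Γ k)} {b : TM2.Cfg Γ Λ σ} (h : TM2.stepAux (M l) v S = b) :
    Steps M 1 ⟨some l, v, S⟩ b := by
  subst h; rfl

/-- Machine code simulates the program that it was generated from, step by step. -/
theorem Run.steps [DecidableEq K] {Λ : Type} {M : Λ → TM2.Stmt Γ Λ σ} {c : Cmd Γ σ}
    {s s' : State Γ σ} {t : ℕ} (h : Run c s t s') : ∀ (e : c.Label → Λ) (exit : Λ),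
    (∀ l, M (e l) = c.code e exit l) →
    Steps M t ⟨some (e c.entry), s.1, s.2⟩ ⟨some exit, s'.1, s'.2⟩ := by
  induction h with
  | push k f v S =>
    intro e exit hM
    exact Steps.single (by rw [hM]; rfl)
  | pop k f v S =>
    intro e exit hM
    exact Steps.single (by rw [hM]; rfl)
  | @seq a b s t s' t' s'' _ _ ih ih' =>
    intro e exit hM
    exact (ih (fun l => e (Sum.inl l)) _ fun l => hM (Sum.inl l)).trans
      (ih' (fun l => e (Sum.inr l)) _ fun l => hM (Sum.inr l))
  | @switch f v S t s' _ ih =>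
    intro e exit hM
    refine Steps.trans (Steps.single ?_) (ih (fun l => e (some ⟨v, l⟩)) exit fun l => hM
        (some ⟨v, l⟩))
    erw [hM none]; rfl
  | @loop_done k f p body v S hp =>
    intro e exit hM
    refine Steps.single ?_
    erw [hM none]
    simp [Cmd.code, hp]
  | @loop_step k f p body v S t s' t' s'' hp _ _ ih ih' =>
    intro e exit hM
    refine Steps.trans (Steps.single ?_)
      ((ih (fun l => e (some l)) (e none) fun l => hM (some l)).trans (ih' e exit hM))
    erw [hM none]
    simp [Cmd.code, hp]

/-- The machine that runs a program and then halts. -/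
noncomputable def Cmd.toFinTM2 [DecidableEq K] [Fintype K] [Fintype σ] [∀ k, Fintype (Γ k)]
    (c : Cmd Γ σ) (k₀ k₁ : K) (v₀ : σ) : FinTM2 where
  K := K
  k₀ := k₀
  k₁ := k₁
  Γ := Γ
  Λ := Option c.Label
  main := some c.entry
  σ := σ
  initialState := v₀
  m
    -- A halting configuration must carry the initial memory, hence the reset. It is the extra step
    -- in `Run.outputs`.
    | none => .load (fun _ => v₀) .halt
    | some l => c.code some none l

theorem Run.outputs [DecidableEq K] [Fintype K] [Fintype σ] [∀ k, Fintype (Γ k)]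
    {c : Cmd Γ σ} {k₀ k₁ : K} {v₀ v : σ} {t m : ℕ} {l : List (Γ k₀)} {l' : List (Γ k₁)}
    (h : Run c (v₀, update (fun _ => []) k₀ l) t (v, update (fun _ => []) k₁ l')) (hm : t + 1 ≤ m) :
    Nonempty (TM2OutputsInTime (c.toFinTM2 k₀ k₁ v₀) l (some l') m) := by
  refine ⟨⟨⟨t + 1, ?_⟩, hm⟩⟩
  have h1 := h.steps (M := (c.toFinTM2 k₀ k₁ v₀).m) some none fun _ => rfl
  have h2 := h1.trans (Steps.single (M := (c.toFinTM2 k₀ k₁ v₀).m) (b := ⟨none, v₀, _⟩) rfl)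
  -- `initList` and `haltList` describe their stacks by a dependent case distinction, which is
  -- rewritten as an `update` of empty stacks.
  have key : ∀ (k' : K) (w : List (Γ k')), (fun k => @dite (List (Γ k)) (k = k') _
      (fun h => by rw [h]; exact w) fun _ => []) = update (fun _ => []) k' w := by
    intro k' w
    funext k
    unfold update
    split_ifs with hk
    · subst hk; rfl
    · rfl
  have e1 : initList (c.toFinTM2 k₀ k₁ v₀) l =
      ⟨some (some c.entry), v₀, update (fun _ => []) k₀ l⟩ := by
    unfold initList
    congr 1
    exact key k₀ l
  have e2 : haltList (c.toFinTM2 k₀ k₁ v₀) l' =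
      ⟨none, v₀, update (fun _ => []) k₁ l'⟩ := by
    unfold haltList
    congr 1
    exact key k₁ l'
  exact (congrArg (flip bind (TM2.step (c.toFinTM2 k₀ k₁ v₀).m))^[t + 1] (congrArg some e1)).trans
    (Eq.trans h2 (congrArg some e2).symm)

end StackProgram

/-! ### Binary trees on stacks -/

namespace StackProgram

open Turing Function

/-- Binary trees, the universal type of data. -/
inductive DTree where
  | leaf
  | node (l r : DTree)

/-- The alphabet of the working stacks. -/
inductive Cell where
  | leaf
  | node
  | mark
  deriving DecidableEq

instance : Fintype Cell := ⟨{.leaf, .node, .mark}, fun x => by cases x <;> simp⟩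

namespace DTree

/-- The prefix code of a tree. -/
def word : DTree → List Cell
  | leaf => [.leaf]
  | node l r => .node :: (l.word ++ r.word)

/-- The length of the prefix code of a tree. -/
def size : DTree → ℕ
  | leaf => 1
  | node l r => l.size + r.size + 1

@[simp] theorem length_word : ∀ t : DTree, t.word.length = t.size
  | leaf => rfl
  | node l r => by simp [word, size, length_word l, length_word r]

theorem size_pos : ∀ t : DTree, 0 < t.size
  | leaf => Nat.one_pos
  | node _ _ => Nat.succ_pos _

theorem mark_notMem_word : ∀ t : DTree, Cell.mark ∉ t.word
  | leaf => by simp [word]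
  | node l r => by simp [word, mark_notMem_word l, mark_notMem_word r]

end DTree

/-- The working stacks: trees are kept on the first three of them, the last one is a counter. -/
inductive Work where
  | s
  | a
  | b
  | c
  deriving DecidableEq

instance : Fintype Work := ⟨{.s, .a, .b, .c}, fun x => by cases x <;> simp⟩

/-- An input stack, an output stack and the working stacks. -/
inductive Stack where
  | inp
  | out
  | work (w : Work)
  deriving DecidableEq, Fintype

/-- The alphabets of the stacks. -/
abbrev Alphabet : Stack → Type
  | .inp => MaxSAT.Symbol
  | .out => Option Bool
  | .work _ => Cell

instance : ∀ k, Fintype (Alphabet k)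
  | .inp => inferInstanceAs (Fintype MaxSAT.Symbol)
  | .out => inferInstanceAs (Fintype (Option Bool))
  | .work _ => inferInstanceAs (Fintype Cell)

/-- The memory of a machine: the last input symbol and the last working symbol that it has read. -/
abbrev Memory : Type := Option MaxSAT.Symbol × Option Cell

/-- The contents of all stacks. -/
def contents (i : List MaxSAT.Symbol) (o : List (Option Bool)) (W : Work → List Cell) :
    ∀ k, List (Alphabet k)
  | .inp => i
  | .out => o
  | .work w => W w

/-- The contents of the working stacks. -/
def work (s a b c : List Cell) : Work → List Cell
  | .s => s
  | .a => a
  | .b => b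
  | .c => c

section

variable (i i' : List MaxSAT.Symbol) (o o' : List (Option Bool)) (W : Work → List Cell)
  (s a b c x : List Cell)

@[simp] theorem update_contents_inp : update (contents i o W) .inp i' = contents i' o W := by
  funext k; cases k <;> rfl
@[simp] theorem update_contents_out : update (contents i o W) .out o' = contents i o' W := by
  funext k; cases k <;> rfl
@[simp] theorem update_contents_work (w : Work) :
    update (contents i o W) (.work w) x = contents i o (update W w x) := by
  funext k
  rcases k with _ | _ | w'
  · rfl
  · rfl
  · by_cases h : w' = w
    · subst h; simp [contents]
    · simp [contents, h]
@[simp] theorem update_work_s : update (work s a b c) .s x = work x a b c := by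
  funext k; cases k <;> rfl
@[simp] theorem update_work_a : update (work s a b c) .a x = work s x b c := by
  funext k; cases k <;> rfl
@[simp] theorem update_work_b : update (work s a b c) .b x = work s a x c := by
  funext k; cases k <;> rfl
@[simp] theorem update_work_c : update (work s a b c) .c x = work s a b x := by
  funext k; cases k <;> rfl
@[simp] theorem work_s : work s a b c .s = s := rfl
@[simp] theorem work_a : work s a b c .a = a := rfl
@[simp] theorem work_b : work s a b c .b = b := rfl
@[simp] theorem work_c : work s a b c .c = c := rfl

end

/-- Programs over these stacks. -/
abbrev Prog : Type := Cmd Alphabet Memory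

/-- `Exec p W t W'`: the program `p` turns the working stacks `W` into `W'` in `t` steps, and does
not touch the input and the output. -/
def Exec (p : Prog) (W : Work → List Cell) (t : ℕ) (W' : Work → List Cell) : Prop :=
  ∀ i o v, ∃ v', Run p (v, contents i o W) t (v', contents i o W')

/-! ### Elementary programs on the working stacks -/

namespace Prog

/-- Push a symbol. -/
def push (w : Work) (x : Cell) : Prog := Cmd.push (.work w) fun _ => x

/-- Remove the topmost symbol. -/
def drop (w : Work) : Prog := Cmd.pop (.work w) fun v _ => v

/-- Do nothing. -/
def skip : Prog := Cmd.seq (push .c .mark) (drop .c)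

/-- Remove the topmost symbol and continue depending on it. -/
def popThen (w : Work) (f : Option Cell → Prog) : Prog :=
  Cmd.seq (Cmd.pop (.work w) fun v x => (v.1, x)) (Cmd.switch fun v => f v.2)

/-- Repeat `p` as long as the topmost symbol has a property. -/
def whileTop (w : Work) (q : Option Cell → Bool) (p : Prog) : Prog :=
  Cmd.loop (.work w) (fun v x => (v.1, x)) (fun v => q v.2) p

end Prog

open Prog

namespace Exec

variable {p q : Prog} {W W' W'' : Work → List Cell} {t t' : ℕ} {w : Work}

theorem congr (h : Exec p W t W') {V V' : Work → List Cell} {u : ℕ} (hV : V = W) (hu : u = t)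
    (hV' : V' = W') : Exec p V u V' := by
  subst hV hu hV'
  exact h

theorem seq (h : Exec p W t W') (h' : Exec q W' t' W'') : Exec (Cmd.seq p q) W (t + t') W'' := by
  intro i o v
  obtain ⟨v', h⟩ := h i o v
  obtain ⟨v'', h'⟩ := h' i o v'
  exact ⟨v'', h.seq h'⟩

theorem push (w : Work) (x : Cell) (W : Work → List Cell) :
    Exec (Prog.push w x) W 1 (update W w (x :: W w)) := by
  intro i o v
  have := Run.push (.work w) (fun _ : Memory => (x : Alphabet (.work w))) v (contents i o W)
  rw [update_contents_work] at this
  exact ⟨v, this⟩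

theorem drop (w : Work) (W : Work → List Cell) :
    Exec (Prog.drop w) W 1 (update W w (W w).tail) := by
  intro i o v
  have := Run.pop (.work w) (fun (v : Memory) (_ : Option (Alphabet (.work w))) => v) v
    (contents i o W)
  rw [update_contents_work] at this
  exact ⟨v, this⟩

theorem skip (W : Work → List Cell) : Exec Prog.skip W 2 W :=
  ((push .c .mark W).seq (drop .c _)).congr rfl rfl (by simp)

theorem popThen {f : Option Cell → Prog}
    (h : Exec (f (W w).head?) (update W w (W w).tail) t W') :
    Exec (Prog.popThen w f) W (t + 2) W' := by
  intro i o v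
  obtain ⟨v', h⟩ := h i o (v.1, (W w).head?)
  have h1 := Run.pop (.work w)
    (fun (v : Memory) (x : Option (Alphabet (.work w))) => ((v.1, x) : Memory)) v (contents i o W)
  rw [update_contents_work] at h1
  refine ⟨v', ?_⟩
  rw [show t + 2 = 1 + (1 + t) by omega]
  exact h1.seq (Run.switch h)

theorem while_stop {g : Option Cell → Bool} (h : g (W w).head? = false) :
    Exec (Prog.whileTop w g p) W 1 W := by
  intro i o v
  exact ⟨_, Run.loop_done h⟩

theorem while_step {g : Option Cell → Bool} (h : g (W w).head? = true) (h1 : Exec p W t W')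
    (h2 : Exec (Prog.whileTop w g p) W' t' W'') :
    Exec (Prog.whileTop w g p) W (1 + (t + t')) W'' := by
  intro i o v
  obtain ⟨v', h1⟩ := h1 i o (v.1, (W w).head?)
  obtain ⟨v'', h2⟩ := h2 i o v'
  exact ⟨_, Run.loop_step h h1 h2⟩

end Exec

/-! ### Moving and copying trees -/

namespace Prog

/-- Move the topmost tree from the first stack, using `k` to store each symbol. -/
def move (k : Cell → Prog) : Prog :=
  -- The stack `.c` holds one mark for each subtree that is still to be read: a node replaces one
  -- such subtree by two, a leaf completes one.
  Cmd.seq (push .c .mark) <| whileTop .c Option.isSome <| popThen .s fun x =>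
    Cmd.seq (k (x.getD .mark)) (if x = some .node then push .c .mark else drop .c)

/-- Take symbols from the stack `w` up to the next mark, using `k` to store each symbol. -/
def pour (w : Work) (k : Cell → Prog) : Prog :=
  Cmd.seq (whileTop w (fun x => x ≠ some .mark) <| popThen w fun x => k (x.getD .mark)) (drop w)

end Prog

/-- The rest of the loop, after the tree has been read, enters as a hypothesis; so the induction can
chain the left and the right subtree. A symbol costs `n + 4` steps: one test, two to pop and branch,
`n` to store, one on the counter. -/
theorem Exec.move_loop {k : Cell → Prog} {n : ℕ}
    {g : Cell → List Cell × List Cell → List Cell × List Cell}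
    (hk : ∀ x s p c, Exec (k x) (work s p.1 p.2 c) n (work s (g x p).1 (g x p).2 c)) (t : DTree) :
    ∀ (s : List Cell) (p : List Cell × List Cell) (c : List Cell) (m : ℕ) (W : Work → List Cell),
    Exec (Prog.whileTop .c Option.isSome <| Prog.popThen .s fun x =>
        Cmd.seq (k (x.getD .mark)) (if x = some .node then Prog.push .c .mark else Prog.drop .c))
      (work s (t.word.foldl (fun p x => g x p) p).1 (t.word.foldl (fun p x => g x p) p).2 c) m W →
    Exec (Prog.whileTop .c Option.isSome <| Prog.popThen .s fun x =>
        Cmd.seq (k (x.getD .mark)) (if x = some .node then Prog.push .c .mark else Prog.drop .c))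
      (work (t.word ++ s) p.1 p.2 (.mark :: c)) ((n + 4) * t.size + m) W := by
  induction t with
  | leaf =>
    intro s p c m W h
    have hb : Exec (Prog.popThen .s fun x =>
        Cmd.seq (k (x.getD .mark)) (if x = some .node then Prog.push .c .mark else Prog.drop .c))
        (work (Cell.leaf :: s) p.1 p.2 (.mark :: c)) (n + 1 + 2)
        (work s (g .leaf p).1 (g .leaf p).2 c) := by
      apply Exec.popThen
      simpa using (hk .leaf s p (.mark :: c)).seq (Exec.drop .c _)
    refine (Exec.while_step ?_ hb h).congr rfl ?_ rfl
    · rfl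
    · simp only [DTree.size]; ring
  | node l r ihl ihr =>
    intro s p c m W h
    have hb : Exec (Prog.popThen .s fun x =>
        Cmd.seq (k (x.getD .mark)) (if x = some .node then Prog.push .c .mark else Prog.drop .c))
        (work (Cell.node :: (l.word ++ (r.word ++ s))) p.1 p.2 (.mark :: c)) (n + 1 + 2)
        (work (l.word ++ (r.word ++ s)) (g .node p).1 (g .node p).2 (.mark :: .mark :: c)) := by
      apply Exec.popThen
      simpa using (hk .node _ p (.mark :: c)).seq (Exec.push .c .mark _)
    simp only [DTree.word, List.foldl_cons, List.foldl_append] at h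
    refine (Exec.while_step ?_ hb (ihl _ _ _ _ _ (ihr _ _ _ _ _ h))).congr ?_ ?_ rfl
    · rfl
    · simp [DTree.word]
    · simp only [DTree.size]; ring

theorem Exec.move {k : Cell → Prog} {n : ℕ}
    {g : Cell → List Cell × List Cell → List Cell × List Cell}
    (hk : ∀ x s p c, Exec (k x) (work s p.1 p.2 c) n (work s (g x p).1 (g x p).2 c)) (t : DTree)
    (s : List Cell) (p : List Cell × List Cell) :
    Exec (Prog.move k) (work (t.word ++ s) p.1 p.2 []) ((n + 4) * t.size + 2)
      (work s (t.word.foldl (fun p x => g x p) p).1 (t.word.foldl (fun p x => g x p) p).2 []) := by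
  have h := (Exec.push .c .mark (work (t.word ++ s) p.1 p.2 [])).seq
    ((Exec.move_loop hk t s p [] 1 _ (Exec.while_stop rfl)).congr (by simp) rfl rfl)
  exact h.congr rfl (by ring) rfl

/-- The mark below `l` ends the loop, which is why `l` must not contain one. A symbol costs a test,
two steps to pop and branch, and `n` to store it. -/
theorem Exec.pour {w : Work} {k : Cell → Prog} {n : ℕ} {g : Cell → List Cell → List Cell}
    (hw : w ≠ .s) (hk : ∀ x W, Exec (k x) W n (update W .s (g x (W .s)))) (r : List Cell) :
    ∀ (l : List Cell) (W : Work → List Cell), Cell.mark ∉ l →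
    Exec (Prog.pour w k) (update W w (l ++ .mark :: r)) ((n + 3) * l.length + 2)
      (update (update W w r) .s (l.foldl (fun s x => g x s) (W .s))) := by
  suffices ∀ (l : List Cell) (W : Work → List Cell), Cell.mark ∉ l →
    Exec (Prog.whileTop w (fun x => x ≠ some .mark) <| Prog.popThen w fun x => k (x.getD .mark))
      (update W w (l ++ .mark :: r)) ((n + 3) * l.length + 1)
      (update (update W w (.mark :: r)) .s (l.foldl (fun s x => g x s) (W .s))) by
    intro l W hl
    refine ((this l W hl).seq (Exec.drop w _)).congr rfl (by ring) ?_
    simp [update_of_ne hw, update_comm hw]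
  intro l
  induction l with
  | nil =>
    intro W _
    refine (Exec.while_stop (by simp)).congr rfl (by simp) ?_
    rw [update_eq_self_iff.2]
    · rfl
    · simp [update_of_ne hw.symm]
  | cons x l ih =>
    intro W hl
    simp only [List.mem_cons, not_or] at hl
    have h1 : Exec (Prog.popThen w fun x => k (x.getD .mark)) (update W w (x :: l ++ .mark :: r))
        (n + 2)
        (update (update W .s (g x (W .s))) w (l ++ .mark :: r)) := by
      apply Exec.popThen
      have := hk x (update W w (l ++ .mark :: r))
      simpa [update_of_ne hw.symm, update_comm hw] using this
    refine (Exec.while_step ?_ h1 (ih (update W .s (g x (W .s))) hl.2)).congr rfl ?_ ?_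
    · simpa using Ne.symm hl.1
    · simp; ring
    · simp [update_comm hw]

namespace Prog

/-- A tree moved to an auxiliary stack lies there reversed above a mark; pouring it back reverses it
again and restores its prefix code. -/
def moveA : Prog := Cmd.seq (push .a .mark) (move (push .a))
def moveB : Prog := Cmd.seq (push .b .mark) (move (push .b))
def moveAB : Prog := Cmd.seq (Cmd.seq (push .a .mark) (push .b .mark))
  (move fun x => Cmd.seq (push .a x) (push .b x))
def backA : Prog := pour .a (push .s)
def backB : Prog := pour .b (push .s)
def discard : Prog := Cmd.seq moveA (pour .a fun _ => skip)

/-- Duplicate the topmost tree. -/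
def dup : Prog := Cmd.seq moveAB (Cmd.seq backA backB)

end Prog

/-- A tree that is stored on one of the auxiliary stacks. -/
def DTree.stored (t : DTree) (r : List Cell) : List Cell := t.word.reverse ++ .mark :: r

variable (t : DTree) (s a b : List Cell)

theorem Exec.moveA :
    Exec Prog.moveA (work (t.word ++ s) a b []) (5 * t.size + 3) (work s (t.stored a) b []) := by
  have h := (Exec.push .a .mark (work (t.word ++ s) a b [])).seq
    ((Exec.move (k := Prog.push .a) (g := fun x p => (x :: p.1, p.2))
      (fun x s p c => (Exec.push .a x _).congr rfl rfl (by simp)) t s (.mark :: a, b)).congr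
      (by simp) rfl rfl)
  refine h.congr rfl (by ring) ?_
  have key : ∀ (l : List Cell) (p : List Cell × List Cell),
      l.foldl (fun p x => (x :: p.1, p.2)) p = (l.reverse ++ p.1, p.2) := by
    intro l
    induction l with
    | nil => simp
    | cons x l ih => simp [ih]
  rw [key]
  rfl

theorem Exec.moveB :
    Exec Prog.moveB (work (t.word ++ s) a b []) (5 * t.size + 3) (work s a (t.stored b) []) := by
  have h := (Exec.push .b .mark (work (t.word ++ s) a b [])).seq
    ((Exec.move (k := Prog.push .b) (g := fun x p => (p.1, x :: p.2))
      (fun x s p c => (Exec.push .b x _).congr rfl rfl (by simp)) t s (a, .mark :: b)).congr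
      (by simp) rfl rfl)
  refine h.congr rfl (by ring) ?_
  have key : ∀ (l : List Cell) (p : List Cell × List Cell),
      l.foldl (fun p x => (p.1, x :: p.2)) p = (p.1, l.reverse ++ p.2) := by
    intro l
    induction l with
    | nil => simp
    | cons x l ih => simp [ih]
  rw [key]
  rfl

theorem Exec.moveAB :
    Exec Prog.moveAB (work (t.word ++ s) a b []) (6 * t.size + 4)
      (work s (t.stored a) (t.stored b) []) := by
  have h := ((Exec.push .a .mark (work (t.word ++ s) a b [])).seq (Exec.push .b .mark _)).seq
    ((Exec.move (k := fun x => Cmd.seq (Prog.push .a x) (Prog.push .b x))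
      (g := fun x p => (x :: p.1, x :: p.2))
      (fun x s p c => ((Exec.push .a x _).seq (Exec.push .b x _)).congr rfl rfl (by simp)) t s
      (.mark :: a, .mark :: b)).congr (by simp) rfl rfl)
  refine h.congr rfl (by ring) ?_
  have key : ∀ (l : List Cell) (p : List Cell × List Cell),
      l.foldl (fun p x => (x :: p.1, x :: p.2)) p = (l.reverse ++ p.1, l.reverse ++ p.2) := by
    intro l
    induction l with
    | nil => simp
    | cons x l ih => simp [ih]
  rw [key]
  rfl

theorem Exec.backA :
    Exec Prog.backA (work s (t.stored a) b []) (4 * t.size + 2) (work (t.word ++ s) a b []) := by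
  have h := Exec.pour (w := .a) (k := Prog.push .s) (g := fun x s => x :: s) (by simp)
    (fun x W => Exec.push .s x W) a t.word.reverse (work s a b []) (by simp [t.mark_notMem_word])
  refine h.congr ?_ (by simp) ?_
  · simp [DTree.stored]
  · simp

theorem Exec.backB :
    Exec Prog.backB (work s a (t.stored b) []) (4 * t.size + 2) (work (t.word ++ s) a b []) := by
  have h := Exec.pour (w := .b) (k := Prog.push .s) (g := fun x s => x :: s) (by simp)
    (fun x W => Exec.push .s x W) b t.word.reverse (work s a b []) (by simp [t.mark_notMem_word])
  refine h.congr ?_ (by simp) ?_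
  · simp [DTree.stored]
  · simp

theorem Exec.discard :
    Exec Prog.discard (work (t.word ++ s) a b []) (10 * t.size + 5) (work s a b []) := by
  have h := Exec.pour (w := .a) (k := fun _ => Prog.skip) (g := fun _ s => s) (by simp)
    (fun x W => (Exec.skip W).congr rfl rfl (by simp)) a t.word.reverse (work s a b [])
    (by simp [t.mark_notMem_word])
  refine ((Exec.moveA t s a b).seq (h.congr ?_ rfl rfl)).congr rfl ?_ ?_
  · simp [DTree.stored]
  · simp; ring
  · simp

theorem Exec.dup :
    Exec Prog.dup (work (t.word ++ s) a b []) (14 * t.size + 8)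
      (work (t.word ++ (t.word ++ s)) a b []) :=
  ((Exec.moveAB t s a b).seq ((Exec.backA t s a _).seq (Exec.backB t _ a b))).congr rfl
    (by ring) rfl

end StackProgram

/-! ### Functions that are computable in polynomial time -/

namespace StackProgram

open Function

/-- A step pushes at most one symbol. Hence running time bounds the size of values, which is what
composition of polynomial-time functions needs. -/
theorem Run.length_le {K : Type} {Γ : K → Type} {σ : Type} [DecidableEq K] {c : Cmd Γ σ}
    {s s' : State Γ σ} {t : ℕ} (h : Run c s t s') (k : K) :
    (s'.2 k).length ≤ (s.2 k).length + t := by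
  induction h with
  | push k' f v S =>
    by_cases hk : k = k'
    · subst hk; simp
    · simp [hk]
  | pop k' f v S =>
    by_cases hk : k = k'
    · subst hk; simp; omega
    · simp [hk]
  | seq _ _ ih ih' => omega
  | switch _ ih => simp only at ih ⊢; omega
  | loop_done => simp
  | loop_step _ _ _ ih ih' => simp only at ih ih' ⊢; omega

theorem Exec.length_le {p : Prog} {W W' : Work → List Cell} {t : ℕ} (h : Exec p W t W') (w : Work) :
    (W' w).length ≤ (W w).length + t := by
  obtain ⟨v', h⟩ := h [] [] (none, none)
  exact h.length_le (.work w)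

theorem eval_mono (P : Polynomial ℕ) {m n : ℕ} (h : m ≤ n) : P.eval m ≤ P.eval n := by
  rw [Polynomial.eval_eq_sum, Polynomial.eval_eq_sum]
  exact Finset.sum_le_sum fun i _ => Nat.mul_le_mul_left _ (Nat.pow_le_pow_left h i)

/-- Types whose elements are represented by trees. -/
class TreeRepr (α : Type) where
  toTree : α → DTree

open TreeRepr (toTree)

/-- The length of the representation of an element. -/
def size {α : Type} [TreeRepr α] (x : α) : ℕ := (toTree x).size

instance : TreeRepr DTree := ⟨id⟩

instance : TreeRepr Unit := ⟨fun _ => .leaf⟩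

instance : TreeRepr Bool := ⟨fun b => bif b then .node .leaf .leaf else .leaf⟩

instance {α β : Type} [TreeRepr α] [TreeRepr β] : TreeRepr (α × β) :=
  ⟨fun x => .node (toTree x.1) (toTree x.2)⟩

/-- This is the tree of a list with at most one element, so `Option.toList` does not change
representations. -/
instance {α : Type} [TreeRepr α] : TreeRepr (Option α) :=
  ⟨fun x => x.elim .leaf fun a => .node (toTree a) .leaf⟩

/-- The tree that represents a list. -/
def listToTree {α : Type} [TreeRepr α] : List α → DTree
  | [] => .leaf
  | a :: l => .node (toTree a) (listToTree l)

instance {α : Type} [TreeRepr α] : TreeRepr (List α) := ⟨listToTree⟩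

/-- Natural numbers are represented in unary. -/
instance : TreeRepr ℕ := ⟨fun n => toTree (List.replicate n ())⟩

variable {α β γ X : Type} [TreeRepr α] [TreeRepr β] [TreeRepr γ] [TreeRepr X]

theorem toTree_nil : toTree ([] : List α) = .leaf := rfl
theorem toTree_cons (a : α) (l : List α) : toTree (a :: l) = .node (toTree a) (toTree l) := rfl
theorem toTree_pair (a : α) (b : β) : toTree (a, b) = .node (toTree a) (toTree b) := rfl

theorem size_pos (x : α) : 0 < size x := (toTree x).size_pos
@[simp] theorem size_nil : size ([] : List α) = 1 := rfl
@[simp] theorem size_cons (a : α) (l : List α) : size (a :: l) = size a + size l + 1 := rfl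
@[simp] theorem size_pair (a : α) (b : β) : size (a, b) = size a + size b + 1 := rfl
@[simp] theorem size_some (a : α) : size (some a) = size a + 2 := rfl
@[simp] theorem size_none : size (none : Option α) = 1 := rfl
@[simp] theorem size_unit (a : Unit) : size a = 1 := rfl
theorem size_bool (b : Bool) : size b ≤ 3 := by cases b <;> decide
@[simp] theorem size_nat (n : ℕ) : size n = 2 * n + 1 := by
  have : ∀ n, size (List.replicate n ()) = 2 * n + 1 := by
    intro n
    induction n with
    | zero => rfl
    | succ n ih => rw [List.replicate_succ, size_cons, ih]; simp; ring
  exact this n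

theorem length_le_size (l : List α) : l.length ≤ size l := by
  induction l with
  | nil => simp
  | cons a l ih => simp; omega

theorem size_le_of_mem {a : α} {l : List α} (h : a ∈ l) : size a ≤ size l := by
  induction l with
  | nil => simp at h
  | cons b l ih =>
    rcases List.mem_cons.1 h with rfl | h
    · simp; omega
    · have := ih h
      simp; omega

theorem size_append (l l' : List α) : size (l ++ l') + 1 = size l + size l' := by
  induction l with
  | nil => simp; omega
  | cons a l ih => simp only [List.cons_append, size_cons]; omega

theorem size_le_of_prefix {l l' : List α} (h : l' <+: l) : size l' ≤ size l := by
  obtain ⟨r, rfl⟩ := h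
  have := size_append l' r
  have := size_pos r
  omega

/-- The code of an element, as it is stored on stacks. -/
def word (x : α) : List Cell := (toTree x).word

@[simp] theorem length_word (x : α) : (word x).length = size x := (toTree x).length_word

/-- `f` is computable in polynomial time (by a program that replaces the argument on top of the
first stack by the value). -/
def PolyTime (f : α → β) : Prop :=
  ∃ (p : Prog) (T : Polynomial ℕ), ∀ x s a b, ∃ t ≤ T.eval (size x),
    Exec p (work (word x ++ s) a b []) t (work (word (f x) ++ s) a b [])

theorem PolyTime.size_le {f : α → β} (h : PolyTime f) :
    ∃ P : Polynomial ℕ, ∀ x, size (f x) ≤ P.eval (size x) := by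
  obtain ⟨p, T, h⟩ := h
  refine ⟨.X + T, fun x => ?_⟩
  obtain ⟨t, ht, h⟩ := h x [] [] []
  have := h.length_le .s
  simp at this
  simp
  omega

/-- A function that does not change representations. -/
theorem PolyTime.of_toTree_eq {f : α → β} (h : ∀ x, toTree (f x) = toTree x) : PolyTime f := by
  refine ⟨Prog.skip, 2, fun x s a b => ⟨2, by simp, ?_⟩⟩
  rw [word, word, h]
  exact Exec.skip _

theorem PolyTime.id : PolyTime fun x : α => x := .of_toTree_eq fun _ => rfl

theorem PolyTime.comp {g : β → γ} {f : α → β} (hg : PolyTime g) (hf : PolyTime f) :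
    PolyTime fun x => g (f x) := by
  obtain ⟨P, hP⟩ := hf.size_le
  obtain ⟨p, T, hf⟩ := hf
  obtain ⟨q, U, hg⟩ := hg
  refine ⟨.seq p q, T + U.comp P, fun x s a b => ?_⟩
  obtain ⟨t, ht, h⟩ := hf x s a b
  obtain ⟨u, hu, h'⟩ := hg (f x) s a b
  refine ⟨_, ?_, h.seq h'⟩
  have := eval_mono U (hP x)
  simp only [Polynomial.eval_add, Polynomial.eval_comp]
  omega

/-- Push a word onto the first stack. -/
def Prog.pushWord : List Cell → Prog
  | [] => Prog.skip
  | x :: l => .seq (pushWord l) (Prog.push .s x)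

theorem Exec.pushWord (l s a b c : List Cell) :
    Exec (Prog.pushWord l) (work s a b c) (l.length + 2) (work (l ++ s) a b c) := by
  induction l with
  | nil => exact Exec.skip _
  | cons x l ih => exact (ih.seq (Exec.push .s x _)).congr rfl (by simp) (by simp)

theorem PolyTime.const (y : β) : PolyTime fun _ : α => y := by
  refine ⟨.seq Prog.discard (Prog.pushWord (word y)), 10 * .X + Polynomial.C (5 + (size y + 2)),
    fun x s a b => ⟨_, ?_, (Exec.discard (toTree x) s a b).seq (Exec.pushWord (word y) s a b [])⟩⟩
  simp [size]
  ring_nf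
  omega

theorem PolyTime.pair {f : X → α} {g : X → β} (hf : PolyTime f) (hg : PolyTime g) :
    PolyTime fun x => (f x, g x) := by
  obtain ⟨P, hP⟩ := hf.size_le
  obtain ⟨p, T, hf⟩ := hf
  obtain ⟨q, U, hg⟩ := hg
  -- One copy of the argument is turned into `f x` and parked on `.a` while `q` works on the other.
  -- The node symbol pushed at the end joins the two adjacent trees to a pair.
  refine ⟨.seq Prog.dup (.seq p (.seq Prog.moveA (.seq q (.seq Prog.backA (Prog.push .s .node))))),
    14 * .X + T + U + 9 * P + 14, fun x s a b => ?_⟩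
  obtain ⟨t, ht, h⟩ := hf x (word x ++ s) a b
  obtain ⟨u, hu, h'⟩ := hg x s ((toTree (f x)).stored a) b
  have := hP x
  refine ⟨_, ?_, (Exec.dup (toTree x) s a b).seq (h.seq
    ((Exec.moveA (toTree (f x)) _ a b).seq (h'.seq ((Exec.backA (toTree (f x)) _ a b).seq
    ((Exec.push .s .node _).congr rfl rfl ?_)))))⟩
  · simp only [size] at *
    simp
    omega
  · simp [word, toTree_pair, DTree.word]

namespace DTree

/-- The left subtree of a tree. -/
def left : DTree → DTree
  | leaf => leaf
  | node l _ => l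

/-- The right subtree of a tree. -/
def right : DTree → DTree
  | leaf => leaf
  | node _ r => r

/-- Whether a tree has subtrees. -/
def isNode : DTree → Bool
  | leaf => false
  | node _ _ => true

end DTree

theorem PolyTime.left : PolyTime DTree.left := by
  refine ⟨Prog.popThen .s fun x => if x = some .node then
    .seq Prog.moveA (.seq Prog.discard Prog.backA) else Prog.push .s .leaf, 19 * .X + 12,
    fun x s a b => ?_⟩
  cases x with
  | leaf =>
    refine ⟨1 + 2, by simp, Exec.popThen ?_⟩
    refine (Exec.push .s .leaf _).congr rfl rfl ?_
    simp [word, toTree, DTree.left, DTree.word]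
  | node l r =>
    have h := (Exec.moveA l (r.word ++ s) a b).seq
      ((Exec.discard r s (l.stored a) b).seq (Exec.backA l s a b))
    refine ⟨_, ?_, Exec.popThen (h.congr ?_ rfl rfl)⟩
    · simp [size, toTree, DTree.size]; omega
    · simp [word, toTree, DTree.word]

theorem PolyTime.right : PolyTime DTree.right := by
  refine ⟨Prog.popThen .s fun x => if x = some .node then
    Prog.discard else Prog.push .s .leaf, 10 * .X + 7, fun x s a b => ?_⟩
  cases x with
  | leaf =>
    refine ⟨1 + 2, by simp, Exec.popThen ?_⟩
    refine (Exec.push .s .leaf _).congr rfl rfl ?_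
    simp [word, toTree, DTree.right, DTree.word]
  | node l r =>
    refine ⟨_, ?_, Exec.popThen ((Exec.discard l (r.word ++ s) a b).congr ?_ rfl rfl)⟩
    · simp [size, toTree, DTree.size]; omega
    · simp [word, toTree, DTree.word]

theorem PolyTime.isNode : PolyTime DTree.isNode := by
  refine ⟨Prog.popThen .s fun x => if x = some .node then
    .seq Prog.discard (.seq Prog.discard (Prog.pushWord (word true))) else Prog.push .s .leaf,
    10 * .X + 20, fun x s a b => ?_⟩
  cases x with
  | leaf =>
    refine ⟨1 + 2, by simp, Exec.popThen ?_⟩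
    refine (Exec.push .s .leaf _).congr rfl rfl ?_
    simp [word, toTree, DTree.isNode, DTree.word]
  | node l r =>
    refine ⟨_, ?_, Exec.popThen (((Exec.discard l (r.word ++ s) a b).seq
      ((Exec.discard r s a b).seq (Exec.pushWord (word true) s a b []))).congr ?_ rfl rfl)⟩
    · have : size true = 3 := rfl
      simp [this]; simp [size, toTree, DTree.size]; omega
    · simp [word, toTree, DTree.word]

theorem PolyTime.ite {c : X → Bool} {f g : X → α} (hc : PolyTime c) (hf : PolyTime f)
    (hg : PolyTime g) :
    PolyTime fun x => if c x then f x else g x := by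
  obtain ⟨r, V, hc⟩ := hc
  obtain ⟨p, T, hf⟩ := hf
  obtain ⟨q, U, hg⟩ := hg
  -- `true` is `node leaf leaf`, so after its first symbol two leaves have to be dropped; `false` is
  -- a single leaf, already popped.
  refine ⟨.seq Prog.dup (.seq r (Prog.popThen .s fun x => if x = some .node then
    .seq (Prog.drop .s) (.seq (Prog.drop .s) p) else q)), 14 * .X + V + T + U + 12,
    fun x s a b => ?_⟩
  obtain ⟨v, hv, h⟩ := hc x (word x ++ s) a b
  obtain ⟨t, ht, h1⟩ := hf x s a b
  obtain ⟨u, hu, h2⟩ := hg x s a b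
  cases hx : c x
  · rw [hx] at h
    refine ⟨_, ?_, (Exec.dup (toTree x) s a b).seq (h.seq (Exec.popThen (t := u) ?_))⟩
    · simp only [size] at *
      simp
      omega
    · simpa [hx, word, toTree, DTree.word] using h2
  · rw [hx] at h
    refine ⟨_, ?_, (Exec.dup (toTree x) s a b).seq (h.seq (Exec.popThen (t := 1 + (1 + t)) ?_))⟩
    · simp only [size] at *
      simp
      omega
    · have h3 := (Exec.drop .s (work (.leaf :: .leaf :: (word x ++ s)) a b [])).seq
        ((Exec.drop .s _).seq (h1.congr (by simp) rfl rfl))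
      simpa [hx, word, toTree, DTree.word] using h3

/-- Apply the program `p` to the elements of a list one after the other. -/
def Prog.foldl (p : Prog) : Prog :=
  Prog.whileTop .s (fun x => x = some .node) <| .seq (Prog.drop .s) <| .seq Prog.moveA <|
    .seq Prog.moveB <| .seq Prog.backA <| .seq (Prog.push .s .node) <| .seq p Prog.backB

/-- A round parks the head on `.a` and the tail on `.b`, rebuilds the pair of head and accumulator,
applies `p`, and fetches the tail. The bound `B` on all intermediate accumulators cannot be
dispensed with: a polynomial-time step may double the size in each round. -/
theorem Exec.foldl {g : α × β → β} {p : Prog} {T : Polynomial ℕ}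
    (hg : ∀ x s a b, ∃ t ≤ T.eval (size x),
      Exec p (work (word x ++ s) a b []) t (work (word (g x) ++ s) a b []))
    (N B : ℕ) (s a b : List Cell) (l : List α) : ∀ y : β, size l ≤ N →
    (∀ l', l' <+: l → size (l'.foldl (fun y x => g (x, y)) y) ≤ B) →
    ∃ t ≤ l.length * (18 * N + 13 + T.eval (N + B + 1)) + 1,
      Exec p.foldl (work (word l ++ (word y ++ s)) a b []) t
        (work (.leaf :: (word (l.foldl (fun y x => g (x, y)) y) ++ s)) a b []) := by
  induction l with
  | nil =>
    intro y _ _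
    exact ⟨1, by simp, Exec.while_stop rfl⟩
  | cons x l ih =>
    intro y hN hB
    simp only [size_cons] at hN
    obtain ⟨t, ht, h⟩ := ih (g (x, y)) (by omega) fun l' hl' => by
      have := hB (x :: l') (by simpa using hl')
      simpa using this
    obtain ⟨u, hu, h'⟩ := hg (x, y) s a ((toTree l).stored b)
    have hy : size y ≤ B := by simpa using hB [] (List.nil_prefix)
    have hT := eval_mono T (show size (x, y) ≤ N + B + 1 by simp; omega)
    have hb := (Exec.drop .s (work (.node :: (word x ++ (word l ++ (word y ++ s)))) a b [])).seq <|
      ((Exec.moveA (toTree x) (word l ++ (word y ++ s)) a b).congr (by simp [word]) rfl rfl).seq <|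
      (Exec.moveB (toTree l) (word y ++ s) _ b).seq <|
      (Exec.backA (toTree x) (word y ++ s) a _).seq <|
      (Exec.push .s .node _).seq <| (h'.congr (by simp [word, toTree_pair, DTree.word]) rfl
        rfl).seq <| Exec.backB (toTree l) _ a b
    refine ⟨_, ?_, (Exec.while_step rfl hb h).congr ?_ rfl rfl⟩
    · simp only [List.length_cons, size] at *
      ring_nf at *
      omega
    · simp [word, toTree_cons, DTree.word]

theorem PolyTime.foldl_pair {g : α × β → β} (hg : PolyTime g) {l : X → List α}
    {y : X → β} (hl : PolyTime l)
    (hy : PolyTime y) (P : Polynomial ℕ) (hP : ∀ x l', l' <+: l x →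
      size (l'.foldl (fun y x => g (x, y)) (y x)) ≤ P.eval (size x)) :
    PolyTime fun x => (l x).foldl (fun y x => g (x, y)) (y x) := by
  obtain ⟨Q, hQ⟩ := hl.size_le
  obtain ⟨p, T, hg⟩ := hg
  obtain ⟨r, U, h0⟩ := hl.pair hy
  -- Without its node symbol the pair is the list directly above the initial accumulator; the last
  -- `drop` removes the leaf that ends the list.
  refine ⟨.seq r (.seq (Prog.drop .s) (.seq p.foldl (Prog.drop .s))),
    U + Q * (18 * Q + 13 + T.comp (Q + P + 1)) + 3, fun x s a b => ?_⟩
  obtain ⟨t, ht, h0⟩ := h0 x s a b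
  obtain ⟨u, hu, h⟩ := Exec.foldl hg (Q.eval (size x)) (P.eval (size x)) s a b (l x) (y x) (hQ x)
    (hP x)
  refine ⟨_, ?_, h0.seq (((Exec.drop .s _).congr rfl rfl ?_).seq (h.seq
    ((Exec.drop .s _).congr rfl rfl ?_)))⟩
  · have h1 := Nat.mul_le_mul_right (18 * Q.eval (size x) + 13 +
      T.eval (Q.eval (size x) + P.eval (size x) + 1)) ((length_le_size (l x)).trans (hQ x))
    simp only [Polynomial.eval_add, Polynomial.eval_mul, Polynomial.eval_comp, Polynomial.eval_one,
      Polynomial.eval_ofNat]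
    omega
  · simp [word, toTree_pair, DTree.word]
  · simp

end StackProgram

/-! ### A library of functions that are computable in polynomial time -/

namespace StackProgram

open TreeRepr (toTree)

variable {α β γ X : Type} [TreeRepr α] [TreeRepr β] [TreeRepr γ] [TreeRepr X]

namespace PolyTime

theorem congr {f g : α → β} (h : PolyTime f) (hfg : ∀ x, f x = g x) : PolyTime g := by
  rwa [← funext hfg]

theorem toTree : PolyTime (TreeRepr.toTree : α → DTree) := of_toTree_eq fun _ => rfl

/-- Computability of a function can be checked on the level of representations. -/
theorem of_tree {f : α → β} (F : DTree → DTree) (hF : PolyTime F)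
    (h : ∀ x, TreeRepr.toTree (f x) = F (TreeRepr.toTree x)) : PolyTime f := by
  obtain ⟨p, T, H⟩ := hF
  refine ⟨p, T, fun x s a b => ?_⟩
  obtain ⟨t, ht, H⟩ := H (TreeRepr.toTree x) s a b
  refine ⟨t, ht, H.congr rfl rfl ?_⟩
  rw [word, h]
  rfl

theorem fst {f : X → α × β} (hf : PolyTime f) : PolyTime fun x => (f x).1 :=
  PolyTime.comp (f := f) (g := Prod.fst) (of_tree _ left fun _ => rfl) hf

theorem snd {f : X → α × β} (hf : PolyTime f) : PolyTime fun x => (f x).2 :=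
  PolyTime.comp (f := f) (g := Prod.snd) (of_tree _ right fun _ => rfl) hf

/-! #### Booleans -/

theorem not {c : X → Bool} (hc : PolyTime c) : PolyTime fun x => !c x :=
  (hc.ite (const false) (const true)).congr fun x => by cases c x <;> rfl

theorem and {c d : X → Bool} (hc : PolyTime c) (hd : PolyTime d) : PolyTime fun x => c x && d x :=
  (hc.ite hd (const false)).congr fun x => by cases c x <;> rfl

theorem beq_bool {c d : X → Bool} (hc : PolyTime c) (hd : PolyTime d) :
    PolyTime fun x => c x == d x :=
  (hc.ite hd hd.not).congr fun x => by cases c x <;> cases d x <;> rfl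

/-! #### Options and basic operations on lists -/

theorem some {f : X → α} (hf : PolyTime f) : PolyTime fun x => Option.some (f x) :=
  (of_toTree_eq fun _ => rfl : PolyTime fun p : α × Unit => Option.some p.1).comp
    (hf.pair (const ()))

theorem isSome {f : X → Option α} (hf : PolyTime f) : PolyTime fun x => (f x).isSome :=
  (isNode.comp (toTree.comp hf)).congr fun x => by cases f x <;> rfl

theorem getD {f : X → Option α} {d : X → α} (hf : PolyTime f) (hd : PolyTime d) :
    PolyTime fun x => (f x).getD (d x) :=
  (of_tree (α := Option α × α) (f := fun p => p.1.getD p.2)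
    (fun t => if t.left.isNode then t.left.left else t.right)
    ((isNode.comp left).ite (left.comp left) right) (by rintro ⟨_ | a, d⟩ <;> rfl)).comp
    (hf.pair hd)

theorem cons {f : X → α} {l : X → List α} (hf : PolyTime f) (hl : PolyTime l) :
    PolyTime fun x => f x :: l x :=
  (of_toTree_eq fun _ => rfl : PolyTime fun p : α × List α => p.1 :: p.2).comp (hf.pair hl)

theorem isEmpty {l : X → List α} (hl : PolyTime l) : PolyTime fun x => (l x).isEmpty :=
  (isNode.comp (toTree.comp hl)).not.congr fun x => by cases l x <;> rfl

theorem tail {l : X → List α} (hl : PolyTime l) : PolyTime fun x => (l x).tail :=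
  (of_tree (α := List α) (f := List.tail) _ right (by rintro (_ | ⟨a, l⟩) <;> rfl)).comp hl

theorem head? {l : X → List α} (hl : PolyTime l) : PolyTime fun x => (l x).head? :=
  (of_tree (α := List α) (f := List.head?)
    (fun t => if t.isNode then TreeRepr.toTree (t.left, DTree.leaf) else .leaf)
    (isNode.ite (toTree.comp (left.pair (const _))) (const _))
    (by rintro (_ | ⟨a, l⟩) <;> rfl)).comp hl

/-! #### Folds -/

/-- A fold is computable in polynomial time if its steps are, and if the intermediate results are
of polynomial size. -/
theorem foldl {f : X → β → α → β} {l : X → List α} {y : X → β} (hl : PolyTime l) (hy : PolyTime y)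
    (hf : PolyTime fun p : X × β × α => f p.1 p.2.1 p.2.2) (P : Polynomial ℕ)
    (hP : ∀ x l', l' <+: l x → size (l'.foldl (f x) (y x)) ≤ P.eval (size x)) :
    PolyTime fun x => (l x).foldl (f x) (y x) := by
  -- The parameter `x` travels inside the accumulator, since the step in `foldl_pair` sees nothing
  -- else besides the list element.
  have key : ∀ (x : X) (l' : List α) (y : β), l'.foldl (fun (y : X × β) a => (y.1, f y.1 y.2 a))
      (x, y) =
      (x, l'.foldl (f x) y) := by
    intro x l'
    induction l' with
    | nil => intro y; rfl
    | cons a l' ih => intro y; exact ih _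
  have h := foldl_pair (g := fun p : α × (X × β) => (p.2.1, f p.2.1 p.2.2 p.1))
    (id.snd.fst.pair (PolyTime.comp hf (id.snd.fst.pair (id.snd.snd.pair id.fst)))) hl (id.pair hy)
    (.X + P + 1) fun x l' hl' => by
      rw [key]
      have := hP x l' hl'
      simp
      omega
  refine h.snd.congr fun x => ?_
  rw [key]

/-- If each step adds an amount bounded in terms of the argument alone, growth is additive, and
polynomially many steps keep the accumulator polynomial. -/
theorem foldl_of_growth {f : X → β → α → β} {l : X → List α} {y : X → β} (hl : PolyTime l)
    (hy : PolyTime y) (hf : PolyTime fun p : X × β × α => f p.1 p.2.1 p.2.2) (Q : Polynomial ℕ)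
    (hQ : ∀ x z a, a ∈ l x → size (f x z a) ≤ size z + Q.eval (size x)) :
    PolyTime fun x => (l x).foldl (f x) (y x) := by
  obtain ⟨R, hR⟩ := hl.size_le
  obtain ⟨S, hS⟩ := hy.size_le
  refine foldl hl hy hf (S + R * Q) fun x l' hl' => ?_
  have h1 : ∀ (l' : List α) (y : β), (∀ a ∈ l', a ∈ l x) →
      size (l'.foldl (f x) y) ≤ size y + l'.length * Q.eval (size x) := by
    intro l'
    induction l' with
    | nil => simp
    | cons a l' ih =>
      intro y h
      have h1 := ih (f x y a) fun a ha => h a (by simp [ha])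
      have h2 := hQ x y a (h a (by simp))
      simp only [List.foldl_cons, List.length_cons]
      linarith
  refine (h1 l' (y x) fun a ha => hl'.subset ha).trans ?_
  simp only [Polynomial.eval_add, Polynomial.eval_mul]
  exact Nat.add_le_add (hS x) (Nat.mul_le_mul_right _
    ((length_le_size l').trans ((size_le_of_prefix hl').trans (hR x))))

/-- The size of a function value `f x a` for an element `a` of a list that depends on `x`. -/
theorem size_elem_le {f : X → α → β} {l : X → List α} (hl : PolyTime l)
    (hf : PolyTime fun p : X × α => f p.1 p.2) :
    ∃ Q : Polynomial ℕ, ∀ x a, a ∈ l x → size (f x a) ≤ Q.eval (size x) := by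
  obtain ⟨R, hR⟩ := hl.size_le
  obtain ⟨S, hS⟩ := hf.size_le
  refine ⟨S.comp (.X + R + 1), fun x a ha => ?_⟩
  refine (hS (x, a)).trans ?_
  rw [Polynomial.eval_comp]
  refine eval_mono S ?_
  have := (size_le_of_mem ha).trans (hR x)
  simp
  omega

theorem reverse {l : X → List α} (hl : PolyTime l) : PolyTime fun x => (l x).reverse := by
  obtain ⟨Q, hQ⟩ := size_elem_le (f := fun _ a => a) hl id.snd
  refine (foldl_of_growth (f := fun _ z a => a :: z) hl (const []) (cons id.snd.snd id.snd.fst)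
    (Q + 1) fun x z a ha => ?_).congr fun x => ?_
  · have := hQ x a ha
    simp
    omega
  · simp

theorem append {l l' : X → List α} (hl : PolyTime l) (hl' : PolyTime l') :
    PolyTime fun x => l x ++ l' x := by
  obtain ⟨Q, hQ⟩ := size_elem_le (f := fun _ a => a) hl.reverse id.snd
  refine (foldl_of_growth (f := fun _ z a => a :: z) hl.reverse hl'
    (cons id.snd.snd id.snd.fst) (Q + 1) fun x z a ha => ?_).congr fun x => ?_
  · have := hQ x a ha
    simp
    omega
  · simp

theorem flatMap {f : X → α → List β} {l : X → List α} (hl : PolyTime l)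
    (hf : PolyTime fun p : X × α => f p.1 p.2) : PolyTime fun x => (l x).flatMap (f x) := by
  obtain ⟨Q, hQ⟩ := size_elem_le hl hf
  refine (foldl_of_growth (f := fun x z a => z ++ f x a) hl (const [])
    (id.snd.fst.append (PolyTime.comp hf (id.fst.pair id.snd.snd))) Q fun x z a ha => ?_).congr
    fun x => ?_
  · have := hQ x a ha
    have := size_append z (f x a)
    omega
  · rw [List.flatMap_eq_foldl]

theorem map {f : X → α → β} {l : X → List α} (hl : PolyTime l)
    (hf : PolyTime fun p : X × α => f p.1 p.2) : PolyTime fun x => (l x).map (f x) :=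
  (flatMap (f := fun x a => [f x a]) hl (cons hf (const []))).congr fun _ =>
    List.map_eq_flatMap.symm

theorem filter {f : X → α → Bool} {l : X → List α} (hl : PolyTime l)
    (hf : PolyTime fun p : X × α => f p.1 p.2) : PolyTime fun x => (l x).filter (f x) :=
  (flatMap (f := fun x a => if f x a then [a] else []) hl
    (hf.ite (cons id.snd (const [])) (const []))).congr fun x => by
    induction l x with
    | nil => rfl
    | cons a l ih => cases h : f x a <;> simp_all

theorem find? {f : X → α → Bool} {l : X → List α} (hl : PolyTime l)
    (hf : PolyTime fun p : X × α => f p.1 p.2) : PolyTime fun x => (l x).find? (f x) :=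
  (hl.filter hf).head?.congr fun _ => List.head?_filter ..

theorem any {f : X → α → Bool} {l : X → List α} (hl : PolyTime l)
    (hf : PolyTime fun p : X × α => f p.1 p.2) : PolyTime fun x => (l x).any (f x) :=
  (hl.find? hf).isSome.congr fun x => by
    rw [Bool.eq_iff_iff]; simp

/-! #### Natural numbers in unary -/

theorem replicate_unit {f : X → ℕ} (hf : PolyTime f) : PolyTime fun x => List.replicate (f x) () :=
  PolyTime.comp (g := fun n => List.replicate n ()) (of_toTree_eq fun _ => rfl) hf

theorem length {l : X → List α} (hl : PolyTime l) : PolyTime fun x => (l x).length :=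
  PolyTime.comp (g := List.length) (f := fun x => (l x).map fun _ => ()) (of_toTree_eq fun l => by
    change TreeRepr.toTree (List.replicate l.length ()) = _
    congr 1
    exact (List.eq_replicate_length.2 fun _ _ => rfl).symm) (hl.map (const ()))
  |>.congr fun x => by simp

theorem succ {f : X → ℕ} (hf : PolyTime f) : PolyTime fun x => f x + 1 :=
  ((const ()).cons hf.replicate_unit).length.congr fun x => by simp

theorem add {f g : X → ℕ} (hf : PolyTime f) (hg : PolyTime g) : PolyTime fun x => f x + g x :=
  (hf.replicate_unit.append hg.replicate_unit).length.congr fun x => by simp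

theorem mul {f g : X → ℕ} (hf : PolyTime f) (hg : PolyTime g) : PolyTime fun x => f x * g x :=
  (hf.replicate_unit.flatMap (f := fun x _ => List.replicate (g x) ())
    (hg.comp id.fst).replicate_unit).length.congr fun x => by simp [List.length_flatMap]

theorem pow {f : X → ℕ} (hf : PolyTime f) : ∀ n : ℕ, PolyTime fun x => f x ^ n
  | 0 => const 1
  | n + 1 => (hf.pow n).mul hf

theorem drop {f : X → ℕ} {l : X → List α} (hf : PolyTime f) (hl : PolyTime l) :
    PolyTime fun x => (l x).drop (f x) := by
  refine (foldl_of_growth (f := fun _ z _ => z.tail) hf.replicate_unit hl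
    id.snd.fst.tail 0 fun x z a ha => ?_).congr fun x => ?_
  · cases z <;> simp; omega
  · generalize f x = n
    generalize l x = l
    induction n generalizing l with
    | zero => rfl
    | succ n ih => rw [List.replicate_succ, List.foldl_cons, ih]; simp

theorem sub {f g : X → ℕ} (hf : PolyTime f) (hg : PolyTime g) : PolyTime fun x => f x - g x :=
  (hg.drop hf.replicate_unit).length.congr fun x => by simp

theorem decide_le {f g : X → ℕ} (hf : PolyTime f) (hg : PolyTime g) :
    PolyTime fun x => decide (f x ≤ g x) :=
  (hf.sub hg).replicate_unit.isEmpty.congr fun x => by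
    rw [Bool.eq_iff_iff]; simp; omega

theorem decide_eq {f g : X → ℕ} (hf : PolyTime f) (hg : PolyTime g) :
    PolyTime fun x => decide (f x = g x) :=
  ((hf.decide_le hg).and (hg.decide_le hf)).congr fun x => by
    rw [Bool.eq_iff_iff]; simp; omega

theorem min {f g : X → ℕ} (hf : PolyTime f) (hg : PolyTime g) : PolyTime fun x => min (f x) (g x) :=
  (hf.sub (hf.sub hg)).congr fun x => by omega

theorem range {f : X → ℕ} (hf : PolyTime f) : PolyTime fun x => List.range (f x) := by
  obtain ⟨P, hP⟩ := hf.size_le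
  have key : ∀ n, (List.replicate n ()).foldl (fun z _ => z ++ [z.length]) [] = List.range n := by
    intro n
    induction n with
    | zero => rfl
    | succ n ih => rw [List.replicate_succ', List.foldl_append, ih]; simp [List.range_succ]
  have hsize : ∀ n, size (List.range n) ≤ (n + 1) * (2 * n + 2) := by
    intro n
    induction n with
    | zero => simp
    | succ n ih =>
      have := size_append (List.range n) [n]
      simp only [size_cons, size_nat, size_nil] at this
      rw [List.range_succ]
      linarith
  -- The appended number depends on the accumulator, so `foldl_of_growth` does not apply; the
  -- intermediate results are ranges, whose size is known.
  refine (foldl (f := fun _ z _ => z ++ [z.length]) hf.replicate_unit (const [])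
    (id.snd.fst.append (id.snd.fst.length.cons (const []))) ((P + 1) * (2 * P + 2))
    fun x l' hl' => ?_).congr fun x => key _
  have hl : l' = List.replicate l'.length () := List.eq_replicate_length.2 fun _ _ => rfl
  have h1 : l'.length ≤ P.eval (size x) := by
    have h1 := hl'.length_le
    have h2 := hP x
    simp at h1 h2
    omega
  rw [hl, key]
  refine (hsize _).trans ?_
  simp only [Polynomial.eval_mul, Polynomial.eval_add, Polynomial.eval_ofNat, Polynomial.eval_one]
  gcongr

theorem sum {l : X → List ℕ} (hl : PolyTime l) : PolyTime fun x => (l x).sum :=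
  (hl.flatMap (f := fun _ n => List.replicate n ()) id.snd.replicate_unit).length.congr fun x => by
    simp [List.length_flatMap]

theorem getElem? {f : X → ℕ} {l : X → List α} (hf : PolyTime f) (hl : PolyTime l) :
    PolyTime fun x => (l x)[f x]? :=
  (hf.drop hl).head?.congr fun x => by simp

end PolyTime

end StackProgram

/-! ### From programs to machines with an input and an output -/

namespace StackProgram

open Turing Function
open TreeRepr (toTree)

/-- A binary code for the symbols of the input alphabet. -/
def symbolCode : MaxSAT.Symbol → Bool × Bool × Bool
  | .var => (false, false, false)
  | .clause => (false, false, true)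
  | .weight => (false, true, false)
  | .literal b => (true, false, b)
  | .bit b => (true, true, b)

instance : TreeRepr MaxSAT.Symbol := ⟨fun x => toTree (symbolCode x)⟩

theorem size_symbol (x : MaxSAT.Symbol) : size x ≤ 11 := by
  have h1 := size_bool (symbolCode x).1
  have h2 := size_bool (symbolCode x).2.1
  have h3 := size_bool (symbolCode x).2.2
  have : size x = size (symbolCode x).1 + (size (symbolCode x).2.1 + size (symbolCode x).2.2 + 1) +
      1 :=
    rfl
  omega

namespace Prog

/-- Move the next input symbol to the first working stack. -/
def readSymbol : Prog :=
  .seq (.pop .inp fun v x => (x, v.2)) <| .switch fun v =>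
    pushWord (v.1.elim [] fun x => .node :: word x)

/-- Move the input to the first working stack. -/
def readInput : Prog :=
  .seq (push .s .leaf) <| .loop .inp (fun v x => (x, v.2)) (fun v => v.1.isSome) readSymbol

/-- Append a symbol to the output. -/
def write (x : Option Bool) : Prog := Cmd.push Stack.out fun _ => x

/-- Move a symbol from the first working stack to the output. -/
def writeSymbol : Prog :=
  -- After the node of the list cell comes `leaf` for `none`, `node leaf leaf` for `some false` and
  -- `node (node leaf leaf) leaf` for `some true`. The drops remove the leaves that need not be
  -- inspected.
  .seq (drop .s) <| popThen .s fun x => if x = some .node then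
    popThen .s fun x => if x = some .node then
      .seq (drop .s) (.seq (drop .s) (.seq (drop .s) (write (some true))))
    else .seq (drop .s) (write (some false))
  else write none

/-- Move a list of symbols from the first working stack to the output. -/
def writeOutput : Prog :=
  .seq (whileTop .s (fun x => x = some .node) writeSymbol) (drop .s)

end Prog

/-- Stacking the symbols reverses the word. A symbol becomes at most 12 cells, pushed in at most 14
steps; testing, popping and branching add three. -/
theorem Run.readInput_loop (l : List MaxSAT.Symbol) : ∀ (l' : List MaxSAT.Symbol) (v : Memory),
    ∃ t ≤ 17 * l.length + 1, ∃ v', Run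
      (.loop .inp (fun v x => (x, v.2)) (fun v => v.1.isSome) Prog.readSymbol)
      (v, contents l [] (work (word l') [] [] [])) t
      (v', contents [] [] (work (word (l.reverse ++ l')) [] [] [])) := by
  induction l with
  | nil => exact fun l' v => ⟨1, by simp, _, Run.loop_done rfl⟩
  | cons x l ih =>
    intro l' v
    obtain ⟨v'', h1⟩ := Exec.pushWord (.node :: word x) (word l') [] [] [] l [] (some x, v.2)
    have h2 := Run.pop (Γ := Alphabet) .inp (fun (v : Memory) x => ((x, v.2) : Memory))
      (some x, v.2) (contents (x :: l) [] (work (word l') [] [] []))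
    obtain ⟨t, ht, v', h⟩ := ih (x :: l') v''
    have hx := size_symbol x
    rw [update_contents_inp] at h2
    refine ⟨_, ?_, v', Run.loop_step (t' := t) rfl (h2.seq (Run.switch h1)) ?_⟩
    rotate_left
    · simpa [word, toTree_cons, DTree.word] using h
    · simp; omega

theorem Run.readInput (l : List MaxSAT.Symbol) (v : Memory) :
    ∃ t ≤ 17 * l.length + 2, ∃ v', Run Prog.readInput
      (v, contents l [] (work [] [] [] [])) t
      (v', contents [] [] (work (word l.reverse) [] [] [])) := by
  obtain ⟨v', h1⟩ := Exec.push .s .leaf (work [] [] [] []) l [] v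
  rw [update_work_s] at h1
  obtain ⟨t, ht, v'', h⟩ := Run.readInput_loop l [] v'
  rw [List.append_nil] at h
  exact ⟨1 + t, by omega, v'', h1.seq h⟩

theorem Run.writeSymbol (x : Option Bool) (o : List (Option Bool)) (s : List Cell) (v : Memory) :
    ∃ t ≤ 9, ∃ v', Run Prog.writeSymbol (v, contents [] o (work (.node :: (word x ++ s)) [] [] []))
        t
      (v', contents [] (x :: o) (work s [] [] [])) := by
  have hw : ∀ s v, Run (Prog.write x) (v, contents [] o (work s [] [] [])) 1
      (v, contents [] (x :: o) (work s [] [] [])) := by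
    intro s v
    have := Run.push (Γ := Alphabet) .out (fun _ : Memory => x) v (contents [] o (work s [] [] []))
    rw [update_contents_out] at this
    exact this
  have hd : ∀ y s v, Run (Prog.drop .s) (v, contents [] o (work (y :: s) [] [] [])) 1
      (v, contents [] o (work s [] [] [])) := by
    intro y s v
    have := Run.pop (Γ := Alphabet) (.work .s) (fun (v : Memory) _ => v) v
      (contents [] o (work (y :: s) [] [] []))
    rw [update_contents_work, update_work_s] at this
    exact this
  have hp : ∀ {f : Option Cell → Prog} {y s v t S}, Run (f (some y)) ((v.1, some y),
      contents [] o (work s [] [] [])) t S →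
      Run (Prog.popThen .s f) (v, contents [] o (work (y :: s) [] [] [])) (1 + (1 + t)) S := by
    intro f y s v t S h
    have := Run.pop (Γ := Alphabet) (.work .s) (fun (v : Memory) x => ((v.1, x) : Memory)) v
      (contents [] o (work (y :: s) [] [] []))
    rw [update_contents_work, update_work_s] at this
    exact this.seq (Run.switch h)
  rcases x with _ | _ | _
  · exact ⟨1 + (1 + (1 + 1)), by simp, (v.1, some .leaf), (hd _ _ _).seq (hp (hw _ _))⟩
  · refine ⟨1 + (1 + (1 + (1 + (1 + (1 + 1))))), by simp, (v.1, some .leaf),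
      (hd _ (.node :: .leaf :: .leaf :: s) _).seq (hp ?_)⟩
    rw [if_pos rfl]
    exact hp ((hd _ _ _).seq (hw _ _))
  · refine ⟨1 + (1 + (1 + (1 + (1 + (1 + (1 + (1 + 1))))))), by simp, (v.1, some .node),
      (hd _ (.node :: .node :: .leaf :: .leaf :: .leaf :: s) _).seq (hp ?_)⟩
    rw [if_pos rfl]
    exact hp ((hd _ _ _).seq ((hd _ _ _).seq ((hd _ _ _).seq (hw _ _))))

theorem Run.writeOutput (l : List (Option Bool)) (v : Memory) :
    ∃ t ≤ 10 * l.length + 2, ∃ v', Run Prog.writeOutput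
      (v, contents [] [] (work (word l) [] [] [])) t
      (v', contents [] l.reverse (work [] [] [] [])) := by
  suffices ∀ (o : List (Option Bool)) (v : Memory), ∃ t ≤ 10 * l.length + 1, ∃ v', Run
      (Prog.whileTop .s (fun x => x = some .node) Prog.writeSymbol)
      (v, contents [] o (work (word l) [] [] [])) t
      (v', contents [] (l.reverse ++ o) (work [.leaf] [] [] [])) by
    obtain ⟨t, ht, v', h⟩ := this [] v
    obtain ⟨v'', h1⟩ := Exec.drop .s (work [.leaf] [] [] []) [] l.reverse v'
    rw [List.append_nil] at h
    exact ⟨t + 1, by omega, v'', h.seq (by simpa using h1)⟩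
  induction l with
  | nil =>
    exact fun o v => ⟨1, by simp, _, Run.loop_done (by simp [contents, word, toTree_nil,
        DTree.word])⟩
  | cons x l ih =>
    intro o v
    obtain ⟨t, ht, v', h⟩ := Run.writeSymbol x o (word l) (v.1, some .node)
    obtain ⟨t', ht', v'', h'⟩ := ih (x :: o) v'
    refine ⟨_, ?_, v'', Run.loop_step (t' := t') ?_ h ?_⟩
    rotate_left 2
    · rw [List.reverse_cons, List.append_assoc]
      exact h'
    · simp; omega
    · rfl

/-- A function on words is computable in polynomial time by a machine with an input and an output if
it is computable in polynomial time on representations by trees. -/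
theorem PolyTime.tm2ComputableInPolyTime {α β : Type} {ea : α → List MaxSAT.Symbol}
    {eb : β → List (Option Bool)} {f : α → β} {F : List MaxSAT.Symbol → List (Option Bool)}
    (hF : PolyTime F) (h : ∀ x, F (ea x) = eb (f x)) :
    Nonempty (TM2ComputableInPolyTime ea eb f) := by
  -- Reading the input and writing the output both reverse a word, so `F` is conjugated with
  -- `List.reverse`.
  obtain ⟨P, hP⟩ := (hF.comp (PolyTime.id.reverse)).reverse.size_le
  obtain ⟨p, T, hp⟩ := (hF.comp (PolyTime.id.reverse)).reverse
  have key : ∀ x, Nonempty (TM2OutputsInTime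
      (Cmd.toFinTM2 (.seq Prog.readInput (.seq p Prog.writeOutput)) Stack.inp .out (none, none))
      (ea x) (Option.some (eb (f x))) (Polynomial.eval (ea x).length
        (17 * .X + (T + 10 * P).comp (12 * .X + 1) + 5))) := by
    intro x
    obtain ⟨t1, ht1, v1, h1⟩ := Run.readInput (ea x) (none, none)
    obtain ⟨t2, ht2, h2⟩ := hp (ea x).reverse [] [] []
    obtain ⟨v2, h2⟩ := h2 [] [] v1
    obtain ⟨t3, ht3, v3, h3⟩ := Run.writeOutput (F (ea x)).reverse v2
    have e1 := hP (ea x).reverse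
    simp only [List.append_nil, List.reverse_reverse] at h2 h3 e1
    have hr := h1.seq (h2.seq h3)
    rw [h] at hr
    have hs : ∀ l : List MaxSAT.Symbol, size l ≤ 12 * l.length + 1 := by
      intro l
      induction l with
      | nil => simp
      | cons y l ih =>
        have := size_symbol y
        simp; omega
    have e2 := hs (ea x).reverse
    rw [List.length_reverse] at e2
    have e3 := eval_mono T e2
    have e4 := eval_mono P e2
    have e5 := length_le_size (F (ea x)).reverse
    refine Run.outputs (Γ := Alphabet) (k₀ := .inp) (k₁ := .out) (v := v3)
        (t := t1 + (t2 + t3)) ?_ ?_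
    · have i1 : ∀ l, contents l [] (work [] [] [] []) =
          update (β := fun k => List (Alphabet k)) (fun _ => []) .inp l := by
        intro l; funext k; rcases k with _ | _ | w <;> first | rfl | (cases w <;> rfl)
      have i2 : ∀ l, contents [] l (work [] [] [] []) =
          update (β := fun k => List (Alphabet k)) (fun _ => []) .out l := by
        intro l; funext k; rcases k with _ | _ | w <;> first | rfl | (cases w <;> rfl)
      rw [i1, i2] at hr
      exact hr
    · simp only [Polynomial.eval_add, Polynomial.eval_comp, Polynomial.eval_mul, Polynomial.eval_X,
        Polynomial.eval_ofNat, Polynomial.eval_one]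
      omega
  exact ⟨{
    tm := Cmd.toFinTM2 (.seq Prog.readInput (.seq p Prog.writeOutput)) Stack.inp .out (none, none)
    inputAlphabet := Equiv.refl _
    outputAlphabet := Equiv.refl _
    time := 17 * .X + (T + 10 * P).comp (12 * .X + 1) + 5
    outputsFun := fun x => by
      have h1 : List.map (Equiv.refl _).invFun (ea x) = ea x := List.map_id _
      have h2 : List.map (Equiv.refl _).invFun (eb (f x)) = eb (f x) := List.map_id _
      exact h1.symm ▸ h2.symm ▸ (key x).some }⟩

end StackProgram

/-! ### The approximation algorithm -/

namespace MaxSAT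

open StackProgram StackProgram.TreeRepr

/-- The number with a given list of binary digits, least significant digit first. -/
def bitsVal (l : List Bool) : ℕ := l.foldr (fun b a => 2 * a + b.toNat) 0

/-- The minimum of `N` and the number with a given list of binary digits. -/
def cappedVal (N : ℕ) (l : List Bool) : ℕ := l.foldr (fun b a => min N (2 * a + b.toNat)) 0

/-- A literal with an explicit number of its variable. -/
abbrev Lit : Type := ℕ × Bool

/-- A clause: its literals, and the binary digits of its weights. -/
abbrev BitClause : Type := List Lit × List (List Bool)

namespace Parser

/-- A literal whose variable is given by binary digits. -/
abbrev RawLit : Type := List Bool × Bool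

/-- The state of the parser: the digits, the literals and the weights that have not been assigned to
a clause yet, the clauses, and the number of variables. -/
abbrev PState : Type :=
  List Bool × List RawLit × List (List Bool) × List (List RawLit × List (List Bool)) × ℕ

/-- Process a symbol (symbols are processed from right to left). -/
def step (s : Symbol) (t : PState) : PState :=
  match s with
  | .bit b => (b :: t.1, t.2)
  | .literal b => ([], (t.1, b) :: t.2.1, t.2.2)
  | .weight => ([], t.2.1, t.1 :: t.2.2.1, t.2.2.2)
  | .clause => ([], [], [], (t.2.1, t.2.2.1) :: t.2.2.2.1, t.2.2.2.2)
  | .var => (t.1, t.2.1, t.2.2.1, t.2.2.2.1, t.2.2.2.2 + 1)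

/-- Process a word. -/
def run (l : List Symbol) : PState := l.foldr step ([], [], [], [], 0)

end Parser

/-- The size of an instance, the number of its variables, and its clauses. -/
abbrev BitCNF : Type := ℕ × ℕ × List BitClause

/-- Read an instance from its code. -/
def parse (l : List Symbol) : BitCNF :=
  -- Indices become unary numbers, and the cap keeps them short on words that code no instance;
  -- indices in genuine codes are below it. The first component is the `N` of the analysis.
  (l.length + 1, (Parser.run l).2.2.2.2, (Parser.run l).2.2.2.1.map fun C =>
    (C.1.map fun a => (cappedVal (l.length + 1) a.1, a.2), C.2))

/-- Negation of literals. -/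
def Lit.neg (l : Lit) : Lit := (l.1, !l.2)

/-- Whether a literal is in a list. -/
def hasLit (P : List Lit) (l : Lit) : Bool := P.any fun l' => decide (l'.1 = l.1) && l'.2 == l.2

/-- Whether a list of true literals makes a clause true. -/
def satBy (P : List Lit) (C : BitClause) : Bool := C.1.any (hasLit P)

/-- Whether the variable of a literal does not occur in a list of literals. -/
def isFree (P : List Lit) (l : Lit) : Bool := !hasLit P l && !hasLit P l.neg

/-- The first literal of a clause whose variable does not occur in a list of literals. -/
def firstFree (P : List Lit) (C : BitClause) : Option Lit := C.1.find? (isFree P)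

/-- The literals over `n` variables. -/
def allLits (n : ℕ) : List Lit := (List.range n).flatMap fun v => [(v, true), (v, false)]

/-- An instance together with a list of literals that are made true, and one scaling exponent for
each objective. -/
abbrev Guess : Type := BitCNF × List Lit × List ℕ

namespace Guess

/-- The scaled and truncated `i`-th weight of a clause. -/
def scaled (e : Guess) (C : BitClause) (i : ℕ) : ℕ :=
  -- Prepending `N` zeros and then dropping `j` digits multiplies by `2 ^ N` and divides by `2 ^ j`
  -- with rounding down, so exponents in `0, …, 2 * N` scale both up and down.
  cappedVal e.1.1 ((((List.replicate e.1.1 ()).map fun _ => false) ++ C.2[i]?.getD []).drop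
    (e.2.2[i]?.getD 0))

/-- The scaled `i`-th weight of all undecided clauses that contain a literal. -/
def load (e : Guess) (l : Lit) (i : ℕ) : ℕ :=
  ((e.1.2.2.filter fun C => !satBy e.2.1 C && hasLit C.1 l).map fun C => e.scaled C i).sum

/-- Whether a literal occurs in clauses of a large total weight, in one of `k` objectives. -/
def heavy (k : ℕ) (e : Guess) (l : Lit) : Bool :=
  (List.range k).any fun i => decide (e.1.1 ≤ e.load l i)

/-- The partial assignment that is forced by a guess: heavy literals are made false. -/
def partialAssignment (k : ℕ) (e : Guess) : List Lit :=
  e.2.1 ++ ((allLits e.1.2.1).filter (e.heavy k)).map Lit.neg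

/-- The scaled weights of a clause, as the digits of a single number. -/
def packed (k : ℕ) (e : Guess) (C : BitClause) : ℕ :=
  -- Fewer than `N` clauses of scaled weight at most `N` sum to at most `N * N` in each objective,
  -- so no carries occur in base `N * N + 1`.
  ∑ i ∈ Finset.range k, e.scaled C i * (e.1.1 * e.1.1 + 1) ^ i

end Guess

/-- A guess together with a partial assignment. -/
abbrev PartialGuess : Type := Guess × List Lit

namespace PartialGuess

/-- The packed weight of the undecided clauses whose first free literal is `l`. -/
def gain (k : ℕ) (e : PartialGuess) (l : Lit) : ℕ :=
  ((e.1.1.2.2.filter fun C => !satBy e.2 C && hasLit (firstFree e.2 C).toList l).map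
    (e.1.packed k)).sum

/-- An upper bound for packed weights. -/
def maxGain (k : ℕ) (e : PartialGuess) : ℕ := (e.1.1.2.2.map (e.1.packed k)).sum

end PartialGuess

/-- A table that contains, for each number, at most one list of literals. -/
abbrev Table : Type := List (Option (List Lit))

/-- The entry of a table at a number that is reduced by `c`. -/
def Table.get (T : Table) (s c : ℕ) : Option (List Lit) :=
  if decide (c ≤ s) then T[s - c]?.getD none else none

namespace PartialGuess

/-- The new entry of the table at the number `s` when the variable `v` is processed. -/
def entry (k : ℕ) (e : PartialGuess) (T : Table) (v s : ℕ) : Option (List Lit) :=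
  if (T.get s (e.gain k (v, true))).isSome then
    some ((v, true) :: (T.get s (e.gain k (v, true))).getD [])
  else if (T.get s (e.gain k (v, false))).isSome then
    some ((v, false) :: (T.get s (e.gain k (v, false))).getD [])
  else none

/-- Process the variable `v`. -/
def tableStep (k : ℕ) (e : PartialGuess) (T : Table) (v : ℕ) : Table :=
  (List.range (e.maxGain k + 1)).map (e.entry k T v)

/-- For each number, an assignment for which the sum of the gains is this number. -/
def table (k : ℕ) (e : PartialGuess) : Table :=
  (List.range e.1.1.2.1).foldl (e.tableStep k) [some []]

/-- The value of a variable under a list of true literals. -/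
def value (R : List Lit) (v : ℕ) : Bool := ((R.find? fun l => decide (l.1 = v)).getD (0, false)).2

/-- The truth assignments that arise from a partial assignment. -/
def results (k : ℕ) (e : PartialGuess) : List (List Bool) :=
  -- `value` uses the first entry of a variable, so the partial assignment overrides the table.
  (e.table k).map fun Q => (List.range e.1.1.2.1).map (value (e.2 ++ Q.getD []))

end PartialGuess

/-- All lists of at most `r` literals over `n` variables. -/
def litLists (n : ℕ) : ℕ → List (List Lit)
  | 0 => [[]]
  | r + 1 => [] :: (litLists n r).flatMap fun G => (allLits n).map fun l => l :: G

/-- All lists of `k` numbers up to `M`. -/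
def exponentLists (M : ℕ) : ℕ → List (List ℕ)
  | 0 => [[]]
  | k + 1 => (exponentLists M k).flatMap fun J => (List.range (M + 1)).map fun j => j :: J

/-- The results for all guesses of at most `r` literals and of the scaling exponents. -/
def approx (k r : ℕ) (x : BitCNF) : List (List Bool) :=
  (litLists x.2.1 r).flatMap fun G => (exponentLists (2 * x.1) k).flatMap fun J =>
    PartialGuess.results k ((x, G, J), Guess.partialAssignment k (x, G, J))

/-! ### The running time of the algorithm -/

/-- Truncation may be done after every digit: a value that has reached `N` cannot fall below it by
doubling. So no large number ever arises in unary. -/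
theorem cappedVal_eq (N : ℕ) (l : List Bool) : cappedVal N l = min N (bitsVal l) := by
  induction l with
  | nil => simp [cappedVal, bitsVal]
  | cons b l ih =>
    change min N (2 * cappedVal N l + b.toNat) = min N (2 * bitsVal l + b.toNat)
    omega

section PolyTime

variable {X : Type} [TreeRepr X]

theorem poly_toNat {c : X → Bool} (hc : PolyTime c) : PolyTime fun x => (c x).toNat :=
  (hc.ite (.const 1) (.const 0)).congr fun x => by cases c x <;> rfl

theorem poly_cappedVal {N : X → ℕ} {l : X → List Bool} (hN : PolyTime N) (hl : PolyTime l) :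
    PolyTime fun x => cappedVal (N x) (l x) := by
  obtain ⟨P, hP⟩ := hN.size_le
  refine (PolyTime.foldl (f := fun x a b => min (N x) (2 * a + Bool.toNat b)) hl.reverse (.const 0)
    ((hN.comp PolyTime.id.fst).min (((PolyTime.const 2).mul PolyTime.id.snd.fst).add
      (poly_toNat PolyTime.id.snd.snd))) (P + 1) fun x l' _ => ?_).congr fun x => ?_
  · have h1 : ∀ (l' : List Bool) (a : ℕ), a ≤ N x →
        l'.foldl (fun a b => min (N x) (2 * a + Bool.toNat b)) a ≤ N x := by
      intro l'
      induction l' with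
      | nil => simp
      | cons b l' ih => exact fun a _ => ih _ (Nat.min_le_left _ _)
    have h2 := h1 l' 0 (Nat.zero_le _)
    have h3 := hP x
    simp only [size_nat, Polynomial.eval_add, Polynomial.eval_one] at *
    omega
  · simp [cappedVal]

namespace Parser

theorem poly_symbolCode : PolyTime symbolCode := .of_toTree_eq fun _ => rfl

theorem poly_step : PolyTime fun p : PState × Symbol => step p.2 p.1 := by
  have hc : PolyTime fun p : PState × Symbol => symbolCode p.2 := poly_symbolCode.comp
      PolyTime.id.snd
  have ht : PolyTime fun p : PState × Symbol => p.1 := PolyTime.id.fst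
  refine (hc.fst.ite
    (hc.snd.fst.ite ((hc.snd.snd.cons ht.fst).pair ht.snd)
      ((PolyTime.const []).pair (((ht.fst.pair hc.snd.snd).cons ht.snd.fst).pair ht.snd.snd)))
    (hc.snd.fst.ite
      ((PolyTime.const []).pair (ht.snd.fst.pair ((ht.fst.cons ht.snd.snd.fst).pair
          ht.snd.snd.snd)))
      (hc.snd.snd.ite
        ((PolyTime.const []).pair ((PolyTime.const []).pair ((PolyTime.const []).pair
          (((ht.snd.fst.pair ht.snd.snd.fst).cons ht.snd.snd.snd.fst).pair ht.snd.snd.snd.snd))))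
        (ht.fst.pair (ht.snd.fst.pair (ht.snd.snd.fst.pair (ht.snd.snd.snd.fst.pair
          ht.snd.snd.snd.snd.succ))))))).congr ?_
  rintro ⟨⟨_, _, _, _, _⟩, s⟩
  cases s <;> rfl

theorem poly_run : PolyTime run := by
  refine (PolyTime.foldl_of_growth (f := fun _ t s => step s t) PolyTime.id.reverse
    (.const ([], [], [], [], 0)) (poly_step.comp PolyTime.id.snd) (Polynomial.C 20)
    fun _ z s _ => ?_).congr fun l => ?_
  · obtain ⟨b, l, w, c, n⟩ := z
    cases s with
    | bit d => have := size_bool d; simp [step]; omega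
    | literal d => have := size_bool d; simp [step]; omega
    | weight => simp [step]; omega
    | clause => simp [step]; omega
    | var => simp [step]; omega
  · simp [run]

end Parser

theorem poly_parse : PolyTime parse := by
  refine PolyTime.id.length.succ.pair (Parser.poly_run.snd.snd.snd.snd.pair
    (Parser.poly_run.snd.snd.snd.fst.map
      (f := fun (l : List Symbol) (C : List Parser.RawLit × List (List Bool)) =>
        (C.1.map fun a => (cappedVal (l.length + 1) a.1, a.2), C.2))
      (PolyTime.pair ?_ PolyTime.id.snd.snd)))
  exact PolyTime.id.snd.fst.map
      (f := fun (p : List Symbol × (List Parser.RawLit × List (List Bool))) (a : Parser.RawLit) =>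
        (cappedVal (p.1.length + 1) a.1, a.2)) <|
    (poly_cappedVal PolyTime.id.fst.fst.length.succ PolyTime.id.snd.fst).pair PolyTime.id.snd.snd

theorem poly_neg {l : X → Lit} (hl : PolyTime l) :
    PolyTime fun x => (l x).neg :=
  hl.fst.pair hl.snd.not

theorem poly_hasLit {P : X → List Lit} {l : X → Lit} (hP : PolyTime P) (hl : PolyTime l) :
    PolyTime fun x => hasLit (P x) (l x) :=
  hP.any (f := fun x (l' : Lit) => decide (l'.1 = (l x).1) && l'.2 == (l x).2) <|
    (PolyTime.id.snd.fst.decide_eq (hl.comp PolyTime.id.fst).fst).and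
      (PolyTime.id.snd.snd.beq_bool (hl.comp PolyTime.id.fst).snd)

theorem poly_satBy {P : X → List Lit} {C : X → BitClause} (hP : PolyTime P) (hC : PolyTime C) :
    PolyTime fun x => satBy (P x) (C x) :=
  hC.fst.any (poly_hasLit (hP.comp PolyTime.id.fst) PolyTime.id.snd)

theorem poly_isFree {P : X → List Lit} {l : X → Lit} (hP : PolyTime P) (hl : PolyTime l) :
    PolyTime fun x => isFree (P x) (l x) :=
  (poly_hasLit hP hl).not.and (poly_hasLit hP (poly_neg hl)).not

theorem poly_firstFree {P : X → List Lit} {C : X → BitClause} (hP : PolyTime P) (hC : PolyTime C) :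
    PolyTime fun x => firstFree (P x) (C x) :=
  hC.fst.find? (poly_isFree (hP.comp PolyTime.id.fst) PolyTime.id.snd)

theorem poly_toList {α : Type} [TreeRepr α] {o : X → Option α} (ho : PolyTime o) :
    PolyTime fun x => (o x).toList :=
  PolyTime.comp (g := Option.toList) (.of_toTree_eq fun o => by cases o <;> rfl) ho

theorem poly_allLits {n : X → ℕ} (hn : PolyTime n) : PolyTime fun x => allLits (n x) :=
  hn.range.flatMap (f := fun _ v => [(v, true), (v, false)]) <|
    (PolyTime.id.snd.pair (.const true)).cons ((PolyTime.id.snd.pair (.const false)).cons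
        (.const []))

variable {e : X → Guess} {C : X → BitClause} {l : X → Lit} {i : X → ℕ}

theorem poly_scaled (he : PolyTime e) (hC : PolyTime C) (hi : PolyTime i) :
    PolyTime fun x => (e x).scaled (C x) (i x) :=
  poly_cappedVal he.fst.fst <| ((hi.getElem? he.snd.snd).getD (.const 0)).drop <|
    (he.fst.fst.replicate_unit.map (f := fun _ _ => false) (.const false)).append <|
      (hi.getElem? hC.snd).getD (.const [])

theorem poly_load (he : PolyTime e) (hl : PolyTime l) (hi : PolyTime i) :
    PolyTime fun x => (e x).load (l x) (i x) := by
  refine PolyTime.sum (PolyTime.map (f := fun x C => (e x).scaled C (i x))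
      (PolyTime.filter he.fst.snd.snd ?_)
    (poly_scaled (he.comp PolyTime.id.fst) PolyTime.id.snd (hi.comp PolyTime.id.fst)))
  exact (poly_satBy (he.comp PolyTime.id.fst).snd.fst PolyTime.id.snd).not.and
    (poly_hasLit PolyTime.id.snd.fst (hl.comp PolyTime.id.fst))

theorem poly_heavy (k : ℕ) (he : PolyTime e) (hl : PolyTime l) :
    PolyTime fun x => (e x).heavy k (l x) :=
  (PolyTime.const k).range.any (f := fun x i => decide ((e x).1.1 ≤ (e x).load (l x) i)) <|
    (he.comp PolyTime.id.fst).fst.fst.decide_le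
      (poly_load (he.comp PolyTime.id.fst) (hl.comp PolyTime.id.fst) PolyTime.id.snd)

theorem poly_partialAssignment (k : ℕ) (he : PolyTime e) :
    PolyTime fun x => (e x).partialAssignment k :=
  he.snd.fst.append <| ((poly_allLits he.fst.snd.fst).filter
    (poly_heavy k (he.comp PolyTime.id.fst) PolyTime.id.snd)).map (f := fun _ l => l.neg)
    (poly_neg PolyTime.id.snd)

/-- Here it matters that `k` is fixed: the powers of the base have constant exponents, so packed
weights remain polynomial. -/
theorem poly_packed (k : ℕ) (he : PolyTime e) (hC : PolyTime C) :
    PolyTime fun x => (e x).packed k (C x) := by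
  induction k with
  | zero => exact PolyTime.const 0
  | succ k ih =>
    refine (ih.add ((poly_scaled he hC (.const k)).mul
      ((he.fst.fst.mul he.fst.fst).succ.pow k))).congr fun x => ?_
    rw [Guess.packed, Guess.packed, Finset.sum_range_succ]

variable {d : X → PartialGuess} {v s c : X → ℕ} {T : X → Table}

theorem poly_gain (k : ℕ) (hd : PolyTime d) (hl : PolyTime l) :
    PolyTime fun x => (d x).gain k (l x) := by
  refine PolyTime.sum (PolyTime.map (f := fun x C => (d x).1.packed k C)
    (PolyTime.filter hd.fst.fst.snd.snd ?_) (poly_packed k (hd.comp PolyTime.id.fst).fst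
        PolyTime.id.snd))
  exact (poly_satBy (hd.comp PolyTime.id.fst).snd PolyTime.id.snd).not.and
    (poly_hasLit (poly_toList (poly_firstFree (hd.comp PolyTime.id.fst).snd PolyTime.id.snd))
      (hl.comp PolyTime.id.fst))

theorem poly_maxGain (k : ℕ) (hd : PolyTime d) : PolyTime fun x => (d x).maxGain k :=
  PolyTime.sum (PolyTime.map (f := fun x C => (d x).1.packed k C) hd.fst.fst.snd.snd
    (poly_packed k (hd.comp PolyTime.id.fst).fst PolyTime.id.snd))

theorem poly_tableGet (hT : PolyTime T) (hs : PolyTime s) (hc : PolyTime c) :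
    PolyTime fun x => (T x).get (s x) (c x) :=
  (hc.decide_le hs).ite (((hs.sub hc).getElem? hT).getD (.const none)) (.const none)

theorem poly_entry (k : ℕ) (hd : PolyTime d) (hT : PolyTime T) (hv : PolyTime v) (hs : PolyTime s) :
    PolyTime fun x => (d x).entry k (T x) (v x) (s x) := by
  have h := fun b => poly_tableGet hT hs (poly_gain k hd (hv.pair (.const b)))
  exact (h true).isSome.ite ((hv.pair (.const true)).cons ((h true).getD (.const []))).some <|
    (h false).isSome.ite ((hv.pair (.const false)).cons ((h false).getD (.const []))).some
      (.const none)

theorem poly_tableStep (k : ℕ) (hd : PolyTime d) (hT : PolyTime T) (hv : PolyTime v) :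
    PolyTime fun x => (d x).tableStep k (T x) (v x) :=
  (poly_maxGain k hd).succ.range.map (f := fun x s => (d x).entry k (T x) (v x) s)
    (poly_entry k (hd.comp PolyTime.id.fst) (hT.comp PolyTime.id.fst)
        (hv.comp PolyTime.id.fst) PolyTime.id.snd)

theorem PartialGuess.size_entry_le {k : ℕ} {e : PartialGuess} {T : Table} {B : ℕ}
    (hT : ∀ Q ∈ T, size Q ≤ B) (v s : ℕ) : size (e.entry k T v s) ≤ 2 * v + B + 10 := by
  have h : ∀ c, size ((T.get s c).getD []) ≤ B + 1 := by
    intro c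
    unfold Table.get
    split_ifs
    · rcases h : T[s - c]? with _ | _ | Q
      · simp
      · simp
      · have := hT _ (List.mem_of_getElem? h)
        simp at this ⊢
        omega
    · simp
  have h1 := h (e.gain k (v, true))
  have h2 := h (e.gain k (v, false))
  have h3 := size_bool true
  have h4 := size_bool false
  unfold PartialGuess.entry
  split_ifs
  · simp; omega
  · simp; omega
  · simp

theorem size_table_le {T : Table} {A B : ℕ} (hA : T.length ≤ A) (hB : ∀ Q ∈ T, size Q ≤ B) :
    size T ≤ A * (B + 1) + 1 := by
  refine le_trans ?_ (Nat.add_le_add_right (Nat.mul_le_mul_right _ hA) 1)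
  clear hA
  induction T with
  | nil => simp
  | cons Q T ih =>
    have h1 := hB Q (by simp)
    have h2 := ih fun Q hQ => hB Q (by simp [hQ])
    simp only [size_cons, List.length_cons]
    linarith

/-- A step rebuilds the whole table, so growth is not measured additively. Instead the number of
entries stays at most `maxGain + 1`, and every entry gains at most one literal per variable. -/
theorem poly_table (k : ℕ) (hd : PolyTime d) : PolyTime fun x => (d x).table k := by
  obtain ⟨P, hP⟩ := (poly_maxGain k hd).size_le
  obtain ⟨R, hR⟩ := hd.fst.fst.snd.fst.size_le
  refine hd.fst.fst.snd.fst.range.foldl (f := fun x => (d x).tableStep k) (.const [some []])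
    (poly_tableStep k (hd.comp PolyTime.id.fst) PolyTime.id.snd.fst PolyTime.id.snd.snd)
    ((P + 1) * ((R * (2 * R + 10) + 3) + 1) + 1) fun x l' hl' => ?_
  have h1 : ∀ (l : List ℕ) (T : Table) (B : ℕ), (∀ v ∈ l, v ≤ R.eval (size x)) →
      T.length ≤ P.eval (size x) + 1 → (∀ Q ∈ T, size Q ≤ B) →
      (l.foldl ((d x).tableStep k) T).length ≤ P.eval (size x) + 1 ∧
      ∀ Q ∈ l.foldl ((d x).tableStep k) T,
        size Q ≤ l.length * (2 * R.eval (size x) + 10) + B := by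
    intro l
    induction l with
    | nil => intro T B _ h1 h2; simpa using ⟨h1, h2⟩
    | cons v l ih =>
      intro T B hl h1 h2
      have hv := hl v (by simp)
      have h3 := ih ((d x).tableStep k T v) (2 * R.eval (size x) + 10 + B)
        (fun v hv => hl v (by simp [hv]))
        (by
          have := hP x
          simp only [size_nat] at this
          simp [PartialGuess.tableStep]
          omega)
        (by
          intro Q hQ
          obtain ⟨s, _, rfl⟩ := List.mem_map.1 hQ
          have := PartialGuess.size_entry_le (k := k) (e := d x) h2 v s
          omega)
      refine ⟨h3.1, fun Q hQ => (h3.2 Q hQ).trans ?_⟩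
      simp only [List.length_cons]
      linarith
  have hn := hR x
  rw [size_nat] at hn
  -- The size of `some []` is 3.
  obtain ⟨h2, h3⟩ := h1 l' [some []] 3
    (fun v hv => by
      have := List.mem_range.1 (hl'.subset hv)
      omega)
    (by simp) (by simp)
  have hlen := hl'.length_le
  rw [List.length_range] at hlen
  refine (size_table_le h2 (B := R.eval (size x) * (2 * R.eval (size x) + 10) + 3)
    fun Q hQ => (h3 Q hQ).trans ?_).trans ?_
  · gcongr
    omega
  · simp

theorem poly_value {R : X → List Lit} (hR : PolyTime R) (hv : PolyTime v) :
    PolyTime fun x => PartialGuess.value (R x) (v x) :=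
  ((hR.find? (f := fun x (l : Lit) => decide (l.1 = v x))
    (PolyTime.id.snd.fst.decide_eq (hv.comp PolyTime.id.fst))).getD (.const (0, false))).snd

theorem poly_results (k : ℕ) (hd : PolyTime d) : PolyTime fun x => (d x).results k := by
  refine (poly_table k hd).map (f := fun x Q => (List.range (d x).1.1.2.1).map
    (PartialGuess.value ((d x).2 ++ Q.getD []))) ?_
  exact (hd.comp PolyTime.id.fst).fst.fst.snd.fst.range.map
    (f := fun (p : X × Option (List Lit)) v => PartialGuess.value ((d p.1).2 ++ p.2.getD []) v)
    (poly_value ((hd.comp PolyTime.id.fst.fst).snd.append (PolyTime.id.fst.snd.getD (.const [])))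
      PolyTime.id.snd)

/-- The recursion is on the constant `r`, so there are polynomially many lists. -/
theorem poly_litLists {n : X → ℕ} (hn : PolyTime n) : ∀ r, PolyTime fun x => litLists (n x) r
  | 0 => .const [[]]
  | r + 1 => (PolyTime.const []).cons <| (poly_litLists hn r).flatMap
      (f := fun x G => (allLits (n x)).map fun l => l :: G) <|
      (poly_allLits (hn.comp PolyTime.id.fst)).map (f := fun p l => l :: p.2)
        (PolyTime.id.snd.cons PolyTime.id.fst.snd)

theorem poly_exponentLists {M : X → ℕ} (hM : PolyTime M) :
    ∀ k, PolyTime fun x => exponentLists (M x) k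
  | 0 => .const [[]]
  | k + 1 => (poly_exponentLists hM k).flatMap
      (f := fun x J => (List.range (M x + 1)).map fun j => j :: J) <|
      (hM.comp PolyTime.id.fst).succ.range.map (f := fun p j => j :: p.2)
        (PolyTime.id.snd.cons PolyTime.id.fst.snd)

theorem poly_approx (k r : ℕ) : PolyTime (approx k r) := by
  refine (poly_litLists PolyTime.id.snd.fst r).flatMap (f := fun x G =>
    (exponentLists (2 * x.1) k).flatMap fun J => PartialGuess.results k
      ((x, G, J), Guess.partialAssignment k (x, G, J))) ?_
  refine (poly_exponentLists ((PolyTime.const 2).mul PolyTime.id.fst.fst) k).flatMap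
    (f := fun (p : BitCNF × List Lit) J => PartialGuess.results k
      ((p.1, p.2, J), Guess.partialAssignment k (p.1, p.2, J))) ?_
  have h : PolyTime fun p : (BitCNF × List Lit) × List ℕ => ((p.1.1, p.1.2, p.2) : Guess) :=
    PolyTime.id.fst.fst.pair (PolyTime.id.fst.snd.pair PolyTime.id.snd)
  exact poly_results k (h.pair (poly_partialAssignment k h))

theorem poly_encodeWords : PolyTime MaxProblem.encodeWords :=
  PolyTime.id.flatMap (f := fun _ (u : List Bool) => u.map some ++ [none]) <|
    (PolyTime.id.snd.map (f := fun _ b => some b) PolyTime.id.snd.some).append (.const [none])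

end PolyTime

end MaxSAT

/-! ### Reading an instance from its code -/

namespace MaxSAT

theorem bitsVal_cons (b : Bool) (l : List Bool) : bitsVal (b :: l) = 2 * bitsVal l + b.toNat := rfl

theorem bitsVal_encodePosNum (p : PosNum) : bitsVal (Computability.encodePosNum p) = p := by
  induction p with
  | one => rfl
  | bit0 p ih => rw [Computability.encodePosNum, bitsVal_cons, ih, PosNum.cast_bit0]; simp; omega
  | bit1 p ih => rw [Computability.encodePosNum, bitsVal_cons, ih, PosNum.cast_bit1]; simp; omega

theorem bitsVal_encodeNat (n : ℕ) : bitsVal (Computability.encodeNat n) = n := by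
  have : ∀ m : Num, bitsVal (Computability.encodeNum m) = m := by
    rintro (_ | p)
    · rfl
    · exact bitsVal_encodePosNum p
  rw [Computability.encodeNat, this]
  exact Num.to_of_nat n

theorem bitsVal_drop (l : List Bool) (j : ℕ) : bitsVal (l.drop j) = bitsVal l / 2 ^ j := by
  induction j generalizing l with
  | zero => simp
  | succ j ih =>
    cases l with
    | nil => simp [bitsVal]
    | cons b l =>
      rw [List.drop_succ_cons, ih, bitsVal_cons, pow_succ', ← Nat.div_div_eq_div_mul]
      congr 1
      cases b <;> simp; omega

theorem bitsVal_shift (N : ℕ) (l : List Bool) :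
    bitsVal ((List.replicate N ()).map (fun _ => false) ++ l) = bitsVal l * 2 ^ N := by
  induction N with
  | zero => simp
  | succ N ih =>
    rw [List.replicate_succ, List.map_cons, List.cons_append, bitsVal_cons, ih, pow_succ]
    simp
    ring

theorem bitsVal_lt (l : List Bool) : bitsVal l < 2 ^ l.length := by
  induction l with
  | nil => simp [bitsVal]
  | cons b l ih =>
    rw [bitsVal_cons, List.length_cons, pow_succ]
    cases b <;> simp <;> omega

/-- The clause that is read from the code of a weighted clause. -/
def WeightedClause.toBits {n k : ℕ} (C : WeightedClause n k) : BitClause :=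
  (C.literals.map fun l => (l.1.val, l.2), (List.ofFn C.weight).map Computability.encodeNat)

namespace Parser

theorem foldr_step_bits (l : List Bool) (t : PState) :
    (l.map Symbol.bit).foldr step t = (l ++ t.1, t.2) := by
  induction l with
  | nil => rfl
  | cons b l ih => rw [List.map_cons, List.foldr_cons, ih]; rfl

/-- Markers precede digits, so a parser working from the right has collected all digits of an index
when it meets the marker. -/
theorem foldr_step_literals {n : ℕ} (L : List (Literal n)) (t : PState) (ht : t.1 = []) :
    (L.flatMap encodeLiteral).foldr step t =
      ([], (L.map fun l => (Computability.encodeNat l.1, l.2)) ++ t.2.1, t.2.2) := by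
  induction L with
  | nil => rw [← ht]; rfl
  | cons l L ih =>
    rw [List.flatMap_cons, List.foldr_append, ih, encodeLiteral, List.foldr_cons, encodeNat,
      foldr_step_bits]
    simp [step]

theorem foldr_step_weights (L : List ℕ) (t : PState) (ht : t.1 = []) :
    (L.flatMap encodeWeight).foldr step t =
      ([], t.2.1, L.map Computability.encodeNat ++ t.2.2.1, t.2.2.2) := by
  induction L with
  | nil => rw [← ht]; rfl
  | cons l L ih =>
    rw [List.flatMap_cons, List.foldr_append, ih, encodeWeight, List.foldr_cons, encodeNat,
      foldr_step_bits]
    simp [step]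

/-- The clause that is read by the parser. -/
def rawClause {n k : ℕ} (C : WeightedClause n k) : List RawLit × List (List Bool) :=
  (C.literals.map fun l => (Computability.encodeNat l.1, l.2),
    (List.ofFn C.weight).map Computability.encodeNat)

theorem foldr_step_clauses {n k : ℕ} (L : List (WeightedClause n k)) :
    (L.flatMap WeightedClause.encode).foldr step ([], [], [], [], 0) =
      ([], [], [], L.map rawClause, 0) := by
  induction L with
  | nil => rfl
  | cons C L ih =>
    rw [List.flatMap_cons, List.foldr_append, ih, WeightedClause.encode, List.foldr_cons,
      List.foldr_append, foldr_step_weights _ _ rfl, foldr_step_literals _ _ rfl]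
    simp [step, rawClause]

theorem run_encode {k : ℕ} (x : WeightedCNF k) :
    run x.encode = ([], [], [], x.clauses.map rawClause, x.numVars) := by
  have : ∀ m, (List.replicate m Symbol.var).foldr step ([], [], [], x.clauses.map rawClause, 0) =
      ([], [], [], x.clauses.map rawClause, m) := by
    intro m
    induction m with
    | zero => rfl
    | succ m ih => rw [List.replicate_succ, List.foldr_cons, ih]; rfl
  rw [run, WeightedCNF.encode, List.foldr_append, foldr_step_clauses, this]

end Parser

theorem parse_encode {k : ℕ} (x : WeightedCNF k) :
    parse x.encode = (x.encode.length + 1, x.numVars, x.clauses.map WeightedClause.toBits) := by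
  rw [parse, Parser.run_encode]
  simp only [List.map_map, Prod.mk.injEq, true_and]
  refine List.map_congr_left fun C _ => ?_
  simp only [Function.comp, Parser.rawClause, WeightedClause.toBits, List.map_map, Prod.mk.injEq,
    and_true]
  refine List.map_congr_left fun l _ => ?_
  have h1 := l.1.isLt
  -- Each variable has its own marker in the code; hence capping leaves the indices unchanged.
  have h2 : x.numVars ≤ x.encode.length := by simp [WeightedCNF.encode]
  simp only [Function.comp, cappedVal_eq, bitsVal_encodeNat, Prod.mk.injEq, and_true]
  omega

theorem length_le_length_flatMap {α β : Type} (f : α → List β) {a : α} {l : List α} (h : a ∈ l) :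
    (f a).length ≤ (l.flatMap f).length := by
  induction l with
  | nil => simp at h
  | cons b l ih =>
    rw [List.flatMap_cons, List.length_append]
    rcases List.mem_cons.1 h with rfl | h
    · omega
    · have := ih h
      omega

theorem WeightedCNF.length_clauses_le {k : ℕ} (x : WeightedCNF k) :
    x.clauses.length ≤ x.encode.length := by
  have : ∀ l : List (WeightedClause x.numVars k),
      l.length ≤ (l.flatMap WeightedClause.encode).length := by
    intro l
    induction l with
    | nil => simp
    | cons C l ih =>
      rw [List.flatMap_cons, List.length_append, List.length_cons, WeightedClause.encode,
        List.length_cons]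
      omega
  have := this x.clauses
  rw [WeightedCNF.encode, List.length_append]
  omega

theorem WeightedCNF.weight_lt {k : ℕ} (x : WeightedCNF k) {C : WeightedClause x.numVars k}
    (hC : C ∈ x.clauses) (i : Fin k) : C.weight i < 2 ^ x.encode.length := by
  have h1 := bitsVal_lt (Computability.encodeNat (C.weight i))
  rw [bitsVal_encodeNat] at h1
  refine h1.trans_le (Nat.pow_le_pow_right (by norm_num) ?_)
  have h2 := length_le_length_flatMap encodeWeight (List.mem_ofFn.2 ⟨i, rfl⟩ :
    C.weight i ∈ List.ofFn C.weight)
  have h3 := length_le_length_flatMap WeightedClause.encode hC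
  simp only [encodeWeight, encodeNat, List.length_cons, List.length_map, WeightedCNF.encode,
    WeightedClause.encode, List.length_append] at *
  omega

end MaxSAT

/-! ### Balanced roundings -/

namespace MaxSAT

/-- If there are more than `k` fractional coordinates, then one of them can be made integral without
changing `k` linear functionals. -/
theorem exists_fewer_fractional {V : Type*} [Fintype V] {k : ℕ} (d : V → Fin k → ℝ) {y : V → ℝ}
    (hy : ∀ v, |y v| ≤ 1) (hd : ∀ i, ∑ v, y v * d v i = 0)
    (hk : k < (Finset.univ.filter fun v => |y v| ≠ 1).card) :
    ∃ y' : V → ℝ, (∀ v, |y' v| ≤ 1) ∧ (∀ i, ∑ v, y' v * d v i = 0) ∧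
      (Finset.univ.filter fun v => |y' v| ≠ 1).card <
        (Finset.univ.filter fun v => |y v| ≠ 1).card := by
  classical
  set F := Finset.univ.filter fun v => |y v| ≠ 1 with hF
  have hFm : ∀ v, v ∈ F ↔ |y v| ≠ 1 := fun v => by simp [hF]
  let M : (F → ℝ) →ₗ[ℝ] (Fin k → ℝ) :=
    { toFun := fun z i => ∑ v : F, z v * d v i
      map_add' := fun z z' => by ext i; simp [add_mul, Finset.sum_add_distrib]
      map_smul' := fun a z => by ext i; simp [Finset.mul_sum, mul_assoc] }
  have hker : LinearMap.ker M ≠ ⊥ := LinearMap.ker_ne_bot_of_finrank_lt (by simpa using hk)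
  obtain ⟨z₀, hz₀, hne⟩ := (Submodule.ne_bot_iff _).1 hker
  -- More unknowns than equations give a kernel vector on the fractional coordinates; extended by
  -- zero, it leaves the integral ones alone.
  let z : V → ℝ := fun v => if h : v ∈ F then z₀ ⟨v, h⟩ else 0
  have hz : ∀ i, ∑ v, z v * d v i = 0 := by
    intro i
    have h1 : ∑ v : F, z₀ v * d v i = 0 := congrFun (LinearMap.mem_ker.1 hz₀) i
    rw [← h1, ← Finset.sum_subset (Finset.subset_univ F), ← Finset.sum_coe_sort F]
    · exact Finset.sum_congr rfl fun v _ => by simp [z]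
    · intro v _ hv
      simp [z, hv]
  obtain ⟨v₀, hv₀⟩ : ∃ v, z v ≠ 0 := by
    obtain ⟨v, hv⟩ := Function.ne_iff.1 hne
    exact ⟨v, by simpa [z] using hv⟩
  have hzF : ∀ v, z v ≠ 0 → |y v| < 1 := by
    intro v hv
    have : v ∈ F := by
      by_contra h
      exact hv (by simp [z, h])
    exact lt_of_le_of_ne (hy v) ((hFm v).1 this)
  -- `τ v` is the time at which coordinate `v`, moving with velocity `z v`, reaches `1` or `-1`. At
  -- the smallest such time one coordinate becomes integral and none has left `[-1, 1]`.
  let τ : V → ℝ := fun v => (1 - SignType.sign (z v) * y v) / |z v|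
  obtain ⟨w, hw, hmin⟩ := Finset.exists_min_image (Finset.univ.filter fun v => z v ≠ 0) τ
    ⟨v₀, by simpa using hv₀⟩
  simp only [Finset.mem_filter, Finset.mem_univ, true_and] at hw hmin
  have hτ : 0 ≤ τ w := by
    have h1 := abs_lt.1 (hzF w hw)
    apply div_nonneg _ (abs_nonneg _)
    rcases lt_or_gt_of_ne hw with h | h
    · simp [sign_neg h]; linarith
    · simp [sign_pos h]; linarith
  have hone : |y w + τ w * z w| = 1 := by
    rcases lt_or_gt_of_ne hw with h | h
    · have : y w + τ w * z w = -1 := by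
        simp only [τ, sign_neg h, abs_of_neg h]
        field_simp
        simp
      rw [this]; simp
    · have : y w + τ w * z w = 1 := by
        simp only [τ, sign_pos h, abs_of_pos h]
        field_simp
        simp
      rw [this]; simp
  refine ⟨fun v => y v + τ w * z v, fun v => ?_, fun i => ?_, Finset.card_lt_card ?_⟩
  · by_cases hv : z v = 0
    · simpa [hv] using hy v
    · have h1 := abs_lt.1 (hzF v hv)
      have h2 := hmin v hv
      have h3 : τ w * |z v| ≤ 1 - SignType.sign (z v) * y v := by
        rwa [← le_div_iff₀ (abs_pos.2 hv)]
      rw [abs_le]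
      rcases lt_or_gt_of_ne hv with h | h
      · simp only [sign_neg h, abs_of_neg h, SignType.coe_neg_one] at h3
        have := mul_nonneg hτ (neg_pos.2 h).le
        constructor <;> nlinarith
      · simp only [sign_pos h, abs_of_pos h, SignType.coe_one] at h3
        have := mul_nonneg hτ h.le
        constructor <;> nlinarith
  · simp only [add_mul, Finset.sum_add_distrib, hd, mul_assoc, ← Finset.mul_sum, hz]
    simp
  · refine (Finset.ssubset_iff_of_subset fun v hv => ?_).2 ⟨w, (hFm w).2 (hzF w hw).ne, ?_⟩
    · simp only [Finset.mem_filter, Finset.mem_univ, true_and] at hv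
      rw [hFm]
      by_cases h : z v = 0
      · simpa [h] using hv
      · exact (hzF v h).ne
    · simpa using hone

theorem exists_few_fractional {V : Type*} [Fintype V] {k : ℕ} (d : V → Fin k → ℝ) :
    ∃ y : V → ℝ, (∀ v, |y v| ≤ 1) ∧ (∀ i, ∑ v, y v * d v i = 0) ∧
      (Finset.univ.filter fun v => |y v| ≠ 1).card ≤ k := by
  suffices ∀ m, ∀ y : V → ℝ, (∀ v, |y v| ≤ 1) → (∀ i, ∑ v, y v * d v i = 0) →
      (Finset.univ.filter fun v => |y v| ≠ 1).card ≤ m → ∃ y : V → ℝ, (∀ v, |y v| ≤ 1) ∧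
      (∀ i, ∑ v, y v * d v i = 0) ∧ (Finset.univ.filter fun v => |y v| ≠ 1).card ≤ k from
    this _ 0 (by simp) (by simp) le_rfl
  intro m
  induction m with
  | zero => exact fun y h1 h2 h3 => ⟨y, h1, h2, h3.trans (Nat.zero_le _)⟩
  | succ m ih =>
    intro y h1 h2 h3
    by_cases h : k < (Finset.univ.filter fun v => |y v| ≠ 1).card
    · obtain ⟨y', h1', h2', h3'⟩ := exists_fewer_fractional d h1 h2 h
      exact ih y' h1' h2' (by omega)
    · exact ⟨y, h1, h2, not_lt.1 h⟩

/-- Vectors in `ℝ^k` with small coordinates have a sum of small coordinates for some choice of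
signs. -/
theorem exists_balanced_signs {V : Type*} [Fintype V] {k : ℕ} (d : V → Fin k → ℝ) {N : ℝ}
    (hN0 : 0 ≤ N) (hN : ∀ v i, |d v i| ≤ N) :
    ∃ x : V → Bool, ∀ i, |∑ v, (if x v then 1 else -1) * d v i| ≤ k * N := by
  obtain ⟨y, h1, h2, h3⟩ := exists_few_fractional d
  refine ⟨fun v => decide (0 ≤ y v), fun i => ?_⟩
  -- The sum with coefficients `y` vanishes and integral coordinates equal their signs, so only the
  -- at most `k` fractional ones contribute; rounding moves each by at most 1.
  have h4 : ∑ v, (if decide (0 ≤ y v) = true then (1 : ℝ) else -1) * d v i =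
      ∑ v ∈ Finset.univ.filter fun v => |y v| ≠ 1,
        ((if decide (0 ≤ y v) = true then (1 : ℝ) else -1) - y v) * d v i := by
    refine (sub_zero _).symm.trans ((congrArg _ (h2 i).symm).trans ?_)
    rw [← Finset.sum_sub_distrib, Finset.sum_filter]
    refine Finset.sum_congr rfl fun v _ => ?_
    by_cases hv : |y v| = 1
    · rcases (abs_eq zero_le_one).1 hv with h | h
      · simp [h]
      · simp [h]; norm_num
    · simp only [hv, ne_eq, not_false_eq_true, if_true]
      ring
  rw [h4]
  refine (Finset.abs_sum_le_sum_abs _ _).trans ?_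
  have h5 : ∀ v ∈ Finset.univ.filter fun v => |y v| ≠ 1,
      |((if decide (0 ≤ y v) = true then (1 : ℝ) else -1) - y v) * d v i| ≤ N := by
    intro v _
    rw [abs_mul, ← one_mul N]
    refine mul_le_mul ?_ (hN v i) (abs_nonneg _) zero_le_one
    have := abs_le.1 (h1 v)
    rw [abs_le]
    by_cases hv : 0 ≤ y v
    · simp [hv]; linarith
    · simp only [hv, decide_false, Bool.false_eq_true, if_false]
      push Not at hv
      constructor <;> linarith
  refine (Finset.sum_le_card_nsmul _ _ _ h5).trans ?_
  rw [nsmul_eq_mul]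
  exact mul_le_mul_of_nonneg_right (by exact_mod_cast h3) hN0

/-- Signs are balanced for the differences `c v true i - c v false i`: the signed sum is twice the
chosen sum minus the full sum. -/
theorem exists_balanced_choice {k n N : ℕ} (c : ℕ → Bool → ℕ → ℕ)
    (hc : ∀ v < n, ∀ b, ∀ i < k, c v b i ≤ N) :
    ∃ x : ℕ → Bool, ∀ i < k, ∑ v ∈ Finset.range n, (c v true i + c v false i) ≤
      2 * ∑ v ∈ Finset.range n, c v (x v) i + k * N := by
  obtain ⟨x, hx⟩ := exists_balanced_signs (V := Fin n) (k := k) (N := N)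
    (fun v i => (c v true i : ℝ) - c v false i) (Nat.cast_nonneg _) fun v i => by
      have h1 : (c v true i : ℝ) ≤ N := by exact_mod_cast hc v v.2 true i i.2
      have h2 : (c v false i : ℝ) ≤ N := by exact_mod_cast hc v v.2 false i i.2
      have h3 : (0 : ℝ) ≤ c v true i := Nat.cast_nonneg _
      have h4 : (0 : ℝ) ≤ c v false i := Nat.cast_nonneg _
      rw [abs_le]
      constructor <;> linarith
  refine ⟨fun v => if h : v < n then x ⟨v, h⟩ else false, fun i hi => ?_⟩
  have h := (abs_le.1 (hx ⟨i, hi⟩)).1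
  rw [Finset.sum_range, Finset.sum_range]
  have h1 : ∀ v : Fin n, (if x v then (1 : ℝ) else -1) * ((c v true i : ℝ) - c v false i) =
      2 * c v (x v) i - (c v true i + c v false i) := by
    intro v
    cases x v <;> simp <;> ring
  simp only [h1, Finset.sum_sub_distrib, ← Finset.mul_sum] at h
  have : (∑ v : Fin n, ((c v true i : ℝ) + c v false i)) ≤
      2 * ∑ v : Fin n, (c v (x v) i : ℝ) + k * N := by
    linarith
  simp only [Fin.is_lt, dite_true, Fin.eta]
  exact_mod_cast this

end MaxSAT

/-! ### Sums of weights of clauses -/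

namespace MaxSAT

/-- The sum of `f` over all clauses with the property `p`. -/
def wsum (L : List BitClause) (p : BitClause → Bool) (f : BitClause → ℕ) : ℕ :=
  (L.map fun C => if p C then f C else 0).sum

theorem sum_filter_eq_wsum (L : List BitClause) (p : BitClause → Bool) (f : BitClause → ℕ) :
    ((L.filter p).map f).sum = wsum L p f := by
  unfold wsum
  induction L with
  | nil => rfl
  | cons C L ih => cases h : p C <;> simp [h, ih]

section wsum

variable {L : List BitClause} {p q r : BitClause → Bool} {f g : BitClause → ℕ}

theorem wsum_le_wsum (h : ∀ C ∈ L, p C = true → q C = true ∧ f C ≤ g C) :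
    wsum L p f ≤ wsum L q g := by
  refine List.sum_le_sum fun C hC => ?_
  by_cases hp : p C = true
  · obtain ⟨h1, h2⟩ := h C hC hp
    simpa [hp, h1] using h2
  · simp [hp]

theorem wsum_le_add (h : ∀ C ∈ L, p C = true → q C = true ∨ r C = true) :
    wsum L p f ≤ wsum L q f + wsum L r f := by
  unfold wsum
  rw [← List.sum_map_add]
  refine List.sum_le_sum fun C hC => ?_
  by_cases hp : p C = true
  · rcases h C hC hp with h | h <;> simp [hp, h]
  · simp [hp]

theorem add_wsum_le (h : ∀ C ∈ L, p C = true → r C = true)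
    (h' : ∀ C ∈ L, q C = true → r C = true ∧ p C = false) :
    wsum L p f + wsum L q f ≤ wsum L r f := by
  unfold wsum
  rw [← List.sum_map_add]
  refine List.sum_le_sum fun C hC => ?_
  by_cases hq : q C = true
  · obtain ⟨h1, h2⟩ := h' C hC hq
    simp [hq, h1, h2]
  · by_cases hp : p C = true
    · simp [hp, hq, h C hC hp]
    · simp [hp, hq]

theorem mul_wsum (a : ℕ) : a * wsum L p f = wsum L p fun C => a * f C := by
  unfold wsum
  rw [← List.sum_map_mul_left]
  congr 1
  exact List.map_congr_left fun C _ => by split_ifs <;> simp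

theorem wsum_add : (wsum L p fun C => f C + g C) = wsum L p f + wsum L p g := by
  unfold wsum
  rw [← List.sum_map_add]
  congr 1
  exact List.map_congr_left fun C _ => by split_ifs <;> simp

theorem wsum_const_le (a : ℕ) : (wsum L p fun _ => a) ≤ L.length * a := by
  unfold wsum
  refine (List.sum_le_card_nsmul _ a fun b hb => ?_).trans (by simp)
  obtain ⟨C, _, rfl⟩ := List.mem_map.1 hb
  split_ifs <;> simp

theorem le_wsum {C : BitClause} (hC : C ∈ L) (hp : p C = true) : f C ≤ wsum L p f := by
  refine List.single_le_sum (fun _ _ => Nat.zero_le _) _ (List.mem_map.2 ⟨C, hC, ?_⟩)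
  simp [hp]

theorem sum_wsum {ι : Type*} (s : Finset ι) (P : ι → BitClause → Bool) (F : ι → BitClause → ℕ) :
    ∑ i ∈ s, wsum L (P i) (F i) = (L.map fun C => ∑ i ∈ s, if P i C then F i C else 0).sum := by
  unfold wsum
  induction L with
  | nil => simp
  | cons C L ih => simp [Finset.sum_add_distrib, ih]

end wsum

theorem hasLit_iff {P : List Lit} {l : Lit} : hasLit P l = true ↔ l ∈ P := by
  obtain ⟨v, b⟩ := l
  simp [hasLit]

theorem satBy_iff {P : List Lit} {C : BitClause} : satBy P C = true ↔ ∃ l ∈ C.1, l ∈ P := by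
  simp [satBy, hasLit_iff]

theorem isFree_iff {P : List Lit} {l : Lit} : isFree P l = true ↔ l ∉ P ∧ l.neg ∉ P := by
  simp [isFree, ← hasLit_iff]

/-- Whether a truth assignment makes a clause true. -/
def trueUnder (I : ℕ → Bool) (C : BitClause) : Bool := C.1.any fun l => I l.1 == l.2

theorem trueUnder_iff {I : ℕ → Bool} {C : BitClause} :
    trueUnder I C = true ↔ ∃ l ∈ C.1, I l.1 = l.2 := by
  simp [trueUnder]

/-- The literals of a list are true under a truth assignment of the first `n` variables. -/
def IsTrueList (n : ℕ) (I : ℕ → Bool) (G : List Lit) : Prop := ∀ l ∈ G, l.1 < n ∧ I l.1 = l.2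

/-! ### Guesses -/

theorem mem_allLits {n : ℕ} {l : Lit} : l ∈ allLits n ↔ l.1 < n := by
  obtain ⟨v, b⟩ := l
  cases b <;> simp [allLits]

theorem mem_litLists {n : ℕ} : ∀ {r : ℕ} {G : List Lit}, G.length ≤ r → (∀ l ∈ G, l.1 < n) →
    G ∈ litLists n r
  | 0, [], _, _ => by simp [litLists]
  | r + 1, [], _, _ => by simp [litLists]
  | r + 1, l :: G, h, h' => by
    have := mem_litLists (n := n) (r := r) (G := G) (by simpa using h)
      fun l hl => h' l (by simp [hl])
    simp only [litLists, List.mem_cons, List.mem_flatMap, List.mem_map]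
    exact Or.inr ⟨G, this, l, mem_allLits.2 (h' l (by simp)), rfl⟩

theorem mem_exponentLists {M : ℕ} : ∀ {k : ℕ} {J : List ℕ}, J.length = k → (∀ j ∈ J, j ≤ M) →
    J ∈ exponentLists M k
  | 0, [], _, _ => by simp [exponentLists]
  | k + 1, j :: J, h, h' => by
    have := mem_exponentLists (M := M) (k := k) (J := J) (by simpa using h)
      fun l hl => h' l (by simp [hl])
    simp only [exponentLists, List.mem_flatMap, List.mem_map, List.mem_range]
    exact ⟨J, this, j, Nat.lt_succ_of_le (h' j (by simp)), rfl⟩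

/-! ### Greedy choice of true literals -/

section greedy

variable (L : List BitClause) (n : ℕ) (I : ℕ → Bool)

/-- The clauses that are not decided by `G` and contain the literal `l`. -/
def openWith (G : List Lit) (l : Lit) (C : BitClause) : Bool := !satBy G C && hasLit C.1 l

theorem openWith_iff {G : List Lit} {l : Lit} {C : BitClause} :
    openWith G l C = true ↔ satBy G C = false ∧ l ∈ C.1 := by
  simp [openWith, hasLit_iff]

theorem satBy_mono {G G' : List Lit} (h : G ⊆ G') {C : BitClause} (hC : satBy G C = true) :
    satBy G' C = true := by
  rw [satBy_iff] at *
  obtain ⟨l, h1, h2⟩ := hC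
  exact ⟨l, h1, h h2⟩

theorem openWith_anti {G G' : List Lit} (h : G ⊆ G') {l : Lit} {C : BitClause}
    (hC : openWith G' l C = true) : openWith G l C = true := by
  rw [openWith_iff] at *
  refine ⟨?_, hC.2⟩
  by_contra h'
  rw [Bool.not_eq_false] at h'
  simp [satBy_mono h h'] at hC

/-- Greedy choice of `m` true literals: no other true literal has a large remaining weight. -/
theorem exists_greedy_single (f : BitClause → ℕ) {G₀ : List Lit} (hG₀ : IsTrueList n I G₀) (m : ℕ) :
    ∃ G g, G.length ≤ G₀.length + m ∧ IsTrueList n I G ∧ G₀ ⊆ G ∧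
      (∀ v < n, wsum L (openWith G (v, I v)) f ≤ g) ∧ m * g ≤ wsum L (satBy G) f := by
  induction m with
  | zero =>
    refine ⟨G₀, wsum L (fun _ => true) f, le_rfl, hG₀, List.Subset.refl _, fun v _ => ?_, by simp⟩
    exact wsum_le_wsum fun C _ _ => ⟨rfl, le_rfl⟩
  | succ m ih =>
    obtain ⟨G, g, h1, h2, h3, h4, h5⟩ := ih
    rcases Nat.eq_zero_or_pos n with rfl | hn
    · exact ⟨G, 0, by omega, h2, h3, by simp, by simp⟩
    obtain ⟨v, hv, hmax⟩ := Finset.exists_max_image (Finset.range n)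
      (fun v => wsum L (openWith G (v, I v)) f) ⟨0, by simpa using hn⟩
    rw [Finset.mem_range] at hv
    refine ⟨(v, I v) :: G, wsum L (openWith G (v, I v)) f, by simp; omega, ?_,
      List.Subset.trans h3 (List.subset_cons_self _ _), fun u hu => ?_, ?_⟩
    · intro l hl
      rcases List.mem_cons.1 hl with rfl | hl
      · exact ⟨hv, rfl⟩
      · exact h2 l hl
    · refine le_trans ?_ (hmax u (by simpa using hu))
      exact wsum_le_wsum fun C _ hC => ⟨openWith_anti (List.subset_cons_self _ _) hC, le_rfl⟩
    · have h6 : wsum L (satBy G) f + wsum L (openWith G (v, I v)) f ≤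
          wsum L (satBy ((v, I v) :: G)) f := by
        refine add_wsum_le (fun C _ hC => satBy_mono (List.subset_cons_self _ _) hC)
          fun C _ hC => ?_
        rw [openWith_iff] at hC
        exact ⟨satBy_iff.2 ⟨_, hC.2, by simp⟩, hC.1⟩
      have h7 := Nat.mul_le_mul_left m (h4 v hv)
      rw [add_mul]
      omega

/-- The objectives are treated in turn. Enlarging `G` only shrinks open weights and increases
satisfied weight, so the bounds of earlier objectives survive. -/
theorem exists_greedy (f : ℕ → BitClause → ℕ) (m k : ℕ) :
    ∃ G, G.length ≤ k * m ∧ IsTrueList n I G ∧ ∀ i < k, ∃ g,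
      (∀ v < n, wsum L (openWith G (v, I v)) (f i) ≤ g) ∧ m * g ≤ wsum L (satBy G) (f i) := by
  induction k with
  | zero => exact ⟨[], by simp, by simp [IsTrueList], by simp⟩
  | succ k ih =>
    obtain ⟨G₀, h1, h2, h3⟩ := ih
    obtain ⟨G, g, h4, h5, h6, h7, h8⟩ := exists_greedy_single L n I (f k) h2 m
    refine ⟨G, by rw [add_mul]; omega, h5, fun i hi => ?_⟩
    rcases Nat.lt_succ_iff_lt_or_eq.1 hi with hi | rfl
    · obtain ⟨g', h9, h10⟩ := h3 i hi
      refine ⟨g', fun v hv => le_trans ?_ (h9 v hv), h10.trans ?_⟩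
      · exact wsum_le_wsum fun C _ hC => ⟨openWith_anti h6 hC, le_rfl⟩
      · exact wsum_le_wsum fun C _ hC => ⟨satBy_mono h6 hC, le_rfl⟩
    · exact ⟨g, h7, h8⟩

end greedy

/-- A suitable scaling exponent for weights of the size of `g`. -/
theorem exists_exponent {N g : ℕ} (hg : g < N * 2 ^ N) :
    ∃ j ≤ 2 * N, g * 2 ^ N < N * 2 ^ j ∧ (0 < g → N * 2 ^ j ≤ 2 * (g * 2 ^ N)) := by
  have h2N : g * 2 ^ N < N * 2 ^ (2 * N) := by
    rw [two_mul, pow_add, ← mul_assoc]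
    exact Nat.mul_lt_mul_of_pos_right hg (by positivity)
  rcases Nat.eq_zero_or_pos g with rfl | hg0
  · exact ⟨2 * N, le_rfl, h2N, by simp⟩
  · have hex : ∃ j, g * 2 ^ N < N * 2 ^ j := ⟨_, h2N⟩
    classical
    -- The least admissible exponent is taken; minimality gives the factor 2. It is not zero,
    -- because `2 ^ N ≤ g * 2 ^ N < N` is impossible.
    refine ⟨Nat.find hex, Nat.find_min' hex h2N, Nat.find_spec hex, fun _ => ?_⟩
    rcases h : Nat.find hex with _ | j
    · have h1 : g * 2 ^ N < N * 2 ^ Nat.find hex := Nat.find_spec hex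
      rw [h] at h1
      have h2 := Nat.lt_two_pow_self (n := N)
      have h3 : 2 ^ N ≤ g * 2 ^ N := Nat.le_mul_of_pos_left _ hg0
      rw [pow_zero, mul_one] at h1
      omega
    · have := Nat.find_min hex (m := j) (by omega)
      rw [pow_succ]
      push Not at this
      linarith

/-! ### The table -/

namespace PartialGuess

theorem value_cons (l : Lit) (R : List Lit) (v : ℕ) :
    value (l :: R) v = if l.1 = v then l.2 else value R v := by
  unfold value
  by_cases h : l.1 = v <;> simp [h]

/-- A variable may occur repeatedly in `P`; as all entries are true under the same `I`, the first
one agrees with the rest. -/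
theorem value_append_of_true {I : ℕ → Bool} {P Q : List Lit} (hP : ∀ l ∈ P, I l.1 = l.2) {l : Lit}
    (hl : l ∈ P) : value (P ++ Q) l.1 = l.2 := by
  induction P with
  | nil => simp at hl
  | cons l' P ih =>
    rw [List.cons_append, value_cons]
    split_ifs with h
    · rw [← hP l hl, ← hP l' (by simp), h]
    · refine ih (fun l hl => hP l (by simp [hl])) ?_
      rcases List.mem_cons.1 hl with rfl | hl
      · exact absurd rfl h
      · exact hl

theorem value_append_of_free {P Q : List Lit} {l : Lit} (hl : isFree P l = true) :
    value (P ++ Q) l.1 = value Q l.1 := by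
  induction P with
  | nil => rfl
  | cons l' P ih =>
    rw [isFree_iff] at hl
    rw [List.cons_append, value_cons, if_neg, ih]
    · rw [isFree_iff]
      simp_all
    · intro h
      simp only [List.mem_cons, not_or] at hl
      obtain ⟨v, b⟩ := l
      obtain ⟨v', b'⟩ := l'
      simp only [Lit.neg, Prod.mk.injEq] at *
      cases b <;> cases b' <;> simp_all

/-- The table after the first `m` variables have been processed. -/
def tableAfter (k : ℕ) (e : PartialGuess) (m : ℕ) : Table :=
  (List.range m).foldl (e.tableStep k) [some []]

variable {k : ℕ} {e : PartialGuess}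

theorem tableAfter_succ (m s : ℕ) : (e.tableAfter k (m + 1))[s]? =
    if s < e.maxGain k + 1 then some (e.entry k (e.tableAfter k m) m s) else none := by
  rw [tableAfter, List.range_succ, List.foldl_append]
  change (e.tableStep k (e.tableAfter k m) m)[s]? = _
  simp only [tableStep, List.getElem?_map]
  split_ifs with h
  · simp [h]
  · simp; omega

theorem tableGet_eq_some {T : Table} {s c : ℕ} {Q : List Lit} (h : T.get s c = some Q) :
    c ≤ s ∧ T[s - c]? = some (some Q) := by
  unfold Table.get at h
  split_ifs at h with hc
  refine ⟨of_decide_eq_true hc, ?_⟩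
  rcases hT : T[s - c]? with _ | _ | Q'
  · simp [hT] at h
  · simp [hT] at h
  · simp [hT] at h
    rw [h]

/-- The literal added in front concerns the variable `m`, so it does not affect the values of
smaller variables. -/
theorem table_sound (m : ℕ) : ∀ (s : ℕ) (Q : List Lit), (e.tableAfter k m)[s]? = some (some Q) →
    ∑ v ∈ Finset.range m, e.gain k (v, value Q v) = s := by
  induction m with
  | zero =>
    intro s Q h
    rcases s with _ | s
    · rfl
    · simp [tableAfter] at h
  | succ m ih =>
    intro s Q h
    rw [tableAfter_succ] at h
    split_ifs at h
    simp only [Option.some.injEq] at h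
    have key : ∀ b, ((e.tableAfter k m).get s (e.gain k (m, b))).isSome = true →
        some ((m, b) :: ((e.tableAfter k m).get s (e.gain k (m, b))).getD []) = some Q →
        ∑ v ∈ Finset.range (m + 1), e.gain k (v, value Q v) = s := by
      intro b hb hQ
      obtain ⟨Q', hQ'⟩ := Option.isSome_iff_exists.1 hb
      rw [hQ'] at hQ
      obtain ⟨h1, h2⟩ := tableGet_eq_some hQ'
      have h3 := ih _ _ h2
      simp only [Option.getD_some, Option.some.injEq] at hQ
      subst hQ
      rw [Finset.sum_range_succ, value_cons, if_pos rfl]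
      have h4 : ∑ v ∈ Finset.range m, e.gain k (v, value ((m, b) :: Q') v) =
          ∑ v ∈ Finset.range m, e.gain k (v, value Q' v) := by
        refine Finset.sum_congr rfl fun v hv => ?_
        rw [value_cons, if_neg (by simp at hv ⊢; omega)]
      rw [h4, h3]
      simp only
      omega
    unfold entry at h
    split_ifs at h with h1 h2
    · exact key true h1 h
    · exact key false h2 h

/-- The entry need not come from `x`: another assignment with the same sum may occupy the cell, and
only the sum matters. -/
theorem table_complete (x : ℕ → Bool) (m : ℕ)
    (hm : ∑ v ∈ Finset.range m, e.gain k (v, x v) ≤ e.maxGain k) :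
    ∃ Q, (e.tableAfter k m)[∑ v ∈ Finset.range m, e.gain k (v, x v)]? = some (some Q) := by
  induction m with
  | zero => exact ⟨[], rfl⟩
  | succ m ih =>
    rw [Finset.sum_range_succ] at hm ⊢
    obtain ⟨Q, hQ⟩ := ih (by omega)
    rw [tableAfter_succ, if_pos (by omega)]
    have h1 : (e.tableAfter k m).get
        (∑ v ∈ Finset.range m, e.gain k (v, x v) + e.gain k (m, x m)) (e.gain k (m, x m)) =
        some Q := by
      unfold Table.get
      rw [if_pos (by simp), Nat.add_sub_cancel, hQ]
      rfl
    unfold entry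
    split_ifs with h2 h3
    · exact ⟨_, rfl⟩
    · exact ⟨_, rfl⟩
    · cases hx : x m
      · rw [hx] at h1
        simp [hx, h1] at h3
      · rw [hx] at h1
        simp [hx, h1] at h2

end PartialGuess

theorem digits_unique {B : ℕ} : ∀ {k : ℕ} {a b : ℕ → ℕ}, (∀ i < k, a i < B) → (∀ i < k, b i < B) →
    ∑ i ∈ Finset.range k, a i * B ^ i = ∑ i ∈ Finset.range k, b i * B ^ i → ∀ i < k, a i = b i
  | 0, _, _, _, _, _ => by simp
  | k + 1, a, b, ha, hb, h => by
    have key : ∀ c : ℕ → ℕ, ∑ i ∈ Finset.range (k + 1), c i * B ^ i =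
        B * (∑ i ∈ Finset.range k, c (i + 1) * B ^ i) + c 0 := by
      intro c
      rw [Finset.sum_range_succ', Finset.mul_sum]
      congr 1
      · exact Finset.sum_congr rfl fun i _ => by ring
      · simp
    rw [key, key] at h
    have ha0 := ha 0 (by omega)
    have hb0 := hb 0 (by omega)
    have h0 : a 0 = b 0 := by
      have := congrArg (· % B) h
      simpa [Nat.mul_add_mod, Nat.mod_eq_of_lt ha0, Nat.mod_eq_of_lt hb0] using this
    have h1 : ∑ i ∈ Finset.range k, a (i + 1) * B ^ i =
        ∑ i ∈ Finset.range k, b (i + 1) * B ^ i := by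
      rw [h0] at h
      exact Nat.eq_of_mul_eq_mul_left (by omega) (Nat.add_right_cancel h)
    have h2 := digits_unique (a := fun i => a (i + 1)) (b := fun i => b (i + 1))
      (fun i hi => ha _ (by omega)) (fun i hi => hb _ (by omega)) h1
    intro i hi
    rcases i with _ | i
    · exact h0
    · exact h2 i (by omega)

end MaxSAT

/-! ### The approximation guarantee -/

namespace MaxSAT

/-- The `i`-th weight of a clause. -/
def BitClause.wt (i : ℕ) (C : BitClause) : ℕ := bitsVal (C.2[i]?.getD [])

theorem Guess.scaled_eq (e : Guess) (C : BitClause) (i : ℕ) :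
    e.scaled C i = min e.1.1 (C.wt i * 2 ^ e.1.1 / 2 ^ (e.2.2[i]?.getD 0)) := by
  rw [Guess.scaled, cappedVal_eq, bitsVal_drop, bitsVal_shift]
  rfl

theorem Guess.scaled_mul_le (e : Guess) (C : BitClause) (i : ℕ) :
    2 ^ (e.2.2[i]?.getD 0) * e.scaled C i ≤ 2 ^ e.1.1 * C.wt i := by
  rw [Guess.scaled_eq, mul_comm, mul_comm _ (C.wt i)]
  exact (Nat.mul_le_mul_right _ (min_le_right _ _)).trans (Nat.div_mul_le_self _ _)

/-- A value below the cap was not truncated, so only rounding down has occurred, which loses less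
than one unit. -/
theorem Guess.le_scaled_mul (e : Guess) (C : BitClause) (i : ℕ) (h : e.scaled C i < e.1.1) :
    2 ^ e.1.1 * C.wt i ≤ 2 ^ (e.2.2[i]?.getD 0) * (e.scaled C i + 1) := by
  rw [Guess.scaled_eq] at h ⊢
  rw [min_eq_right (by omega), mul_comm _ (C.wt i)]
  exact (Nat.lt_mul_div_succ _ (by positivity)).le

theorem Guess.load_eq (e : Guess) (l : Lit) (i : ℕ) :
    e.load l i = wsum e.1.2.2 (openWith e.2.1 l) fun C => e.scaled C i :=
  sum_filter_eq_wsum _ _ _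

/-! ### Consequences of a guess -/

section partialAssignment

variable {k : ℕ} {e : Guess} {I : ℕ → Bool}

theorem subset_partialAssignment : e.2.1 ⊆ e.partialAssignment k := List.subset_append_left _ _

/-- Literals true under `I` are light, so the heavy ones are false under `I` and their negations may
be added. -/
theorem isTrueList_partialAssignment (hG : IsTrueList e.1.2.1 I e.2.1)
    (hload : ∀ v < e.1.2.1, ∀ i < k, e.load (v, I v) i < e.1.1) :
    IsTrueList e.1.2.1 I (e.partialAssignment k) := by
  intro l hl
  rcases List.mem_append.1 hl with hl | hl
  · exact hG l hl
  · obtain ⟨⟨v, b⟩, h, rfl⟩ := List.mem_map.1 hl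
    rw [List.mem_filter, mem_allLits] at h
    refine ⟨h.1, ?_⟩
    by_contra hI
    have hb : I v = b := by
      simp only [Lit.neg] at hI
      cases b <;> cases h : I v <;> simp_all
    obtain ⟨i, hi, h2⟩ := List.any_eq_true.1 h.2
    have := hload v h.1 i (by simpa using hi)
    rw [hb] at this
    simp at h2
    omega

theorem load_lt_of_isFree {l : Lit} (hl : isFree (e.partialAssignment k) l = true)
    (hn : l.1 < e.1.2.1) {i : ℕ} (hi : i < k) : e.load l i < e.1.1 := by
  by_contra h
  rw [isFree_iff] at hl
  refine hl.2 (List.mem_append.2 (Or.inr (List.mem_map.2 ⟨l, ?_, rfl⟩)))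
  rw [List.mem_filter, mem_allLits]
  refine ⟨hn, List.any_eq_true.2 ⟨i, by simpa using hi, ?_⟩⟩
  simpa using h

end partialAssignment

/-! ### Crediting clauses to their first free literals -/

section firstFree

variable {P : List Lit} {C : BitClause} {l : Lit}

/-- The undecided clauses whose first free literal is `l`. -/
def openFirst (P : List Lit) (l : Lit) (C : BitClause) : Bool :=
  !satBy P C && hasLit (firstFree P C).toList l

theorem openFirst_iff : openFirst P l C = true ↔ satBy P C = false ∧ firstFree P C = some l := by
  simp [openFirst, hasLit_iff]

theorem mem_of_firstFree (h : firstFree P C = some l) : l ∈ C.1 ∧ isFree P l = true :=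
  ⟨List.mem_of_find?_eq_some h, List.find?_some h⟩

/-- The undecided clauses whose first free literal is true under `x`. -/
def gained (P : List Lit) (x : ℕ → Bool) (C : BitClause) : Bool :=
  !satBy P C && (firstFree P C).any fun l => x l.1 == l.2

/-- The undecided clauses that have a free literal. -/
def undecided (P : List Lit) (C : BitClause) : Bool := !satBy P C && (firstFree P C).isSome

/-- A clause has at most one first free literal, so it is counted for at most one variable. -/
theorem sum_openFirst_le (L : List BitClause) (n : ℕ) (x : ℕ → Bool) (f : BitClause → ℕ) :
    ∑ v ∈ Finset.range n, wsum L (openFirst P (v, x v)) f ≤ wsum L (gained P x) f := by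
  rw [sum_wsum]
  refine List.sum_le_sum fun C _ => ?_
  by_cases hs : satBy P C = true
  · simp [openFirst, hs]
  rcases hC : firstFree P C with _ | ⟨w, b⟩
  · simp [openFirst, hasLit, hC]
  have h1 : ∀ v, (if openFirst P (v, x v) C = true then f C else 0) =
      if v = w then (if x w = b then f C else 0) else 0 := by
    intro v
    rw [← ite_and]
    refine if_congr ?_ rfl rfl
    rw [openFirst_iff, hC]
    simp only [hs, Option.some.injEq, Prod.mk.injEq, true_and]
    constructor
    · rintro ⟨rfl, rfl⟩; exact ⟨rfl, rfl⟩
    · rintro ⟨rfl, rfl⟩; exact ⟨rfl, rfl⟩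
  simp only [h1, Finset.sum_ite_eq']
  by_cases hx : x w = b
  · simp [gained, hs, hC, hx]
    split_ifs <;> simp
  · simp [hx]

theorem undecided_le_sum {L : List BitClause} {n : ℕ} (hL : ∀ C ∈ L, ∀ l ∈ C.1, l.1 < n)
    (f : BitClause → ℕ) : wsum L (undecided P) f ≤
      ∑ v ∈ Finset.range n, (wsum L (openFirst P (v, true)) f +
        wsum L (openFirst P (v, false)) f) := by
  rw [Finset.sum_add_distrib, sum_wsum, sum_wsum, ← List.sum_map_add]
  refine List.sum_le_sum fun C hC' => ?_
  by_cases hs : undecided P C = true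
  · simp only [undecided, Bool.and_eq_true, Bool.not_eq_true', Option.isSome_iff_exists] at hs
    obtain ⟨hs, ⟨w, b⟩, hC⟩ := hs
    have hw : w ∈ Finset.range n := Finset.mem_range.2 (hL C hC' _ (mem_of_firstFree hC).1)
    have h1 : openFirst P (w, b) C = true := openFirst_iff.2 ⟨hs, hC⟩
    have h2 := Finset.single_le_sum (s := Finset.range n)
      (f := fun v => if openFirst P (v, b) C = true then f C else 0) (fun _ _ => Nat.zero_le _) hw
    simp only [h1, if_true] at h2
    refine le_trans (by split_ifs <;> simp) (h2.trans ?_)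
    cases b
    · exact Nat.le_add_left _ _
    · exact Nat.le_add_right _ _
  · simp [hs]

end firstFree

/-! ### Packed gains and their digits -/

section gain

variable {k : ℕ} {e : PartialGuess}

/-- The contributions of a literal to the scaled weights. -/
def PartialGuess.gainAt (e : PartialGuess) (l : Lit) (i : ℕ) : ℕ :=
  wsum e.1.1.2.2 (openFirst e.2 l) fun C => e.1.scaled C i

theorem PartialGuess.gain_eq (l : Lit) :
    e.gain k l = ∑ i ∈ Finset.range k, e.gainAt l i * (e.1.1.1 * e.1.1.1 + 1) ^ i := by
  have h1 : e.gain k l = wsum e.1.1.2.2 (openFirst e.2 l) (e.1.packed k) := sum_filter_eq_wsum _ _ _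
  have h2 : ∀ i, e.gainAt l i * (e.1.1.1 * e.1.1.1 + 1) ^ i = wsum e.1.1.2.2 (openFirst e.2 l)
      fun C => e.1.scaled C i * (e.1.1.1 * e.1.1.1 + 1) ^ i := by
    intro i
    rw [PartialGuess.gainAt, mul_comm, mul_wsum]
    simp only [mul_comm]
  rw [h1, Finset.sum_congr rfl fun i _ => h2 i, sum_wsum, wsum]
  congr 1
  refine List.map_congr_left fun C _ => ?_
  split_ifs
  · rfl
  · simp

/-- Packing is additive: the digits of a sum of gains are the sums in the single objectives. As
these are below the base, equal packed sums force equal vectors. -/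
theorem PartialGuess.sum_gain_eq (n : ℕ) (x : ℕ → Bool) :
    ∑ v ∈ Finset.range n, e.gain k (v, x v) = ∑ i ∈ Finset.range k,
      (∑ v ∈ Finset.range n, e.gainAt (v, x v) i) * (e.1.1.1 * e.1.1.1 + 1) ^ i := by
  simp only [PartialGuess.gain_eq, Finset.sum_mul]
  exact Finset.sum_comm

theorem PartialGuess.sum_gainAt_lt (hlen : e.1.1.2.2.length < e.1.1.1) (n : ℕ) (x : ℕ → Bool)
    (i : ℕ) : ∑ v ∈ Finset.range n, e.gainAt (v, x v) i < e.1.1.1 * e.1.1.1 + 1 := by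
  refine Nat.lt_succ_of_le ((sum_openFirst_le _ _ _ _).trans ?_)
  refine (wsum_le_wsum (q := gained e.2 x) (g := fun _ => e.1.1.1) fun C _ h => ⟨h, ?_⟩).trans
    ((wsum_const_le _).trans (Nat.mul_le_mul_right _ hlen.le))
  rw [Guess.scaled_eq]
  exact min_le_left _ _

theorem PartialGuess.sum_gain_le (n : ℕ) (x : ℕ → Bool) :
    ∑ v ∈ Finset.range n, e.gain k (v, x v) ≤ e.maxGain k := by
  have h : ∀ l, e.gain k l = wsum e.1.1.2.2 (openFirst e.2 l) (e.1.packed k) := fun l =>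
    sum_filter_eq_wsum _ _ _
  simp only [h]
  refine (sum_openFirst_le _ _ _ _).trans (List.sum_le_sum fun C _ => ?_)
  split_ifs <;> simp

/-- The table contains an assignment with the same scaled weights as any given assignment. -/
theorem PartialGuess.exists_mem_table (hlen : e.1.1.2.2.length < e.1.1.1) (x : ℕ → Bool) :
    ∃ Q, some Q ∈ e.table k ∧ ∀ i < k,
      ∑ v ∈ Finset.range e.1.1.2.1, e.gainAt (v, x v) i =
      ∑ v ∈ Finset.range e.1.1.2.1, e.gainAt (v, value Q v) i := by
  obtain ⟨Q, hQ⟩ := PartialGuess.table_complete x e.1.1.2.1 (PartialGuess.sum_gain_le (k := k)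
      (e := e) _ x)
  refine ⟨Q, List.mem_of_getElem? hQ, ?_⟩
  have h := PartialGuess.table_sound _ _ _ hQ
  rw [PartialGuess.sum_gain_eq, PartialGuess.sum_gain_eq] at h
  exact digits_unique (fun i _ => PartialGuess.sum_gainAt_lt hlen _ _ i)
    (fun i _ => PartialGuess.sum_gainAt_lt hlen _ _ i) h.symm

end gain

/-! ### The factor one half -/

section guarantee

variable {k N n : ℕ} {L : List BitClause} {I : ℕ → Bool}

/-- The guarantee in one objective, for a suitable guess. -/
theorem trueUnder_le {G P Q : List Lit} {J : List ℕ} {x : ℕ → Bool} {i g : ℕ} (hi : i < k)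
    (hlen : L.length < N) (hL : ∀ C ∈ L, ∀ l ∈ C.1, l.1 < n)
    (hPe : P = Guess.partialAssignment k ((N, n, L), G, J)) (hP : IsTrueList n I P)
    (hg : ∀ v < n, wsum L (openWith G (v, I v)) (BitClause.wt i) ≤ g)
    (hG : 2 * (k + 1) * g ≤ wsum L (satBy G) (BitClause.wt i))
    (hJ : 0 < g → N * 2 ^ (J[i]?.getD 0) ≤ 2 * (g * 2 ^ N))
    (hx : ∑ v ∈ Finset.range n, (PartialGuess.gainAt (((N, n, L), G, J), P) (v, true) i +
      PartialGuess.gainAt (((N, n, L), G, J), P) (v, false) i) ≤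
      2 * ∑ v ∈ Finset.range n, PartialGuess.gainAt (((N, n, L), G, J), P) (v, x v) i + k * N)
    (hQ : ∑ v ∈ Finset.range n, PartialGuess.gainAt (((N, n, L), G, J), P) (v, x v) i =
      ∑ v ∈ Finset.range n,
        PartialGuess.gainAt (((N, n, L), G, J), P) (v, PartialGuess.value Q v) i) :
    wsum L (trueUnder I) (BitClause.wt i) ≤
      2 * wsum L (trueUnder (PartialGuess.value (P ++ Q))) (BitClause.wt i) := by
  set e : PartialGuess := (((N, n, L), G, J), P) with he
  have hGP : G ⊆ P := by rw [hPe]; exact subset_partialAssignment (e := ((N, n, L), G, J))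
  have hsat : ∀ C, satBy P C = true → trueUnder (PartialGuess.value (P ++ Q)) C = true := by
    intro C hC
    obtain ⟨l, h1, h2⟩ := satBy_iff.1 hC
    exact trueUnder_iff.2 ⟨l, h1,
      PartialGuess.value_append_of_true (fun l hl => (hP l hl).2) h2⟩
  have hmono : wsum L (satBy G) (BitClause.wt i) ≤ wsum L (satBy P) (BitClause.wt i) :=
    wsum_le_wsum fun C _ hC => ⟨satBy_mono hGP hC, le_rfl⟩
  rcases Nat.eq_zero_or_pos g with rfl | hg0
  -- For `g = 0` no scaling is available, but every clause true under `I` and not satisfied by `G`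
  -- then has weight zero.
  · have h1 : wsum L (trueUnder I) (BitClause.wt i) ≤ wsum L (satBy G) (BitClause.wt i) +
        wsum L (fun C => trueUnder I C && !satBy G C) (BitClause.wt i) :=
      wsum_le_add fun C _ hC => by cases h : satBy G C <;> simp [hC]
    have h2 : wsum L (fun C => trueUnder I C && !satBy G C) (BitClause.wt i) ≤
        wsum L (fun _ => true) fun _ => 0 := by
      refine wsum_le_wsum fun C hC h => ⟨rfl, ?_⟩
      simp only [Bool.and_eq_true, Bool.not_eq_true'] at h
      obtain ⟨l, h3, h4⟩ := trueUnder_iff.1 h.1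
      refine le_trans ?_ (hg l.1 (hL C hC l h3))
      refine le_wsum hC (openWith_iff.2 ⟨h.2, ?_⟩)
      rw [h4]
      exact h3
    have h3 := wsum_const_le (L := L) (p := fun _ => true) 0
    have h4 : wsum L (satBy P) (BitClause.wt i) ≤
        wsum L (trueUnder (PartialGuess.value (P ++ Q))) (BitClause.wt i) :=
      wsum_le_wsum fun C _ hC => ⟨hsat C hC, le_rfl⟩
    omega
  · have h1 : wsum L (trueUnder I) (BitClause.wt i) ≤ wsum L (satBy P) (BitClause.wt i) +
        wsum L (undecided P) (BitClause.wt i) := by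
      refine wsum_le_add fun C hC hI => ?_
      by_cases hs : satBy P C = true
      · exact Or.inl hs
      right
      obtain ⟨l, h3, h4⟩ := trueUnder_iff.1 hI
      simp only [undecided, hs, Bool.not_false, Bool.true_and, firstFree, List.find?_isSome]
      -- A literal true under `I` in a clause that `P` does not satisfy is free: it is not in `P`,
      -- and its negation is false under `I`, hence not in `P` either.
      refine ⟨l, h3, isFree_iff.2 ⟨fun h => hs (satBy_iff.2 ⟨l, h3, h⟩), fun h => ?_⟩⟩
      have := (hP _ h).2
      simp [Lit.neg, h4] at this
    have h2 : wsum L (satBy P) (BitClause.wt i) + wsum L (gained P (PartialGuess.value Q))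
        (BitClause.wt i) ≤
        wsum L (trueUnder (PartialGuess.value (P ++ Q))) (BitClause.wt i) := by
      refine add_wsum_le (fun C _ hC => hsat C hC) fun C _ hC => ?_
      simp only [gained, Bool.and_eq_true, Bool.not_eq_true', Option.any_eq_true] at hC
      obtain ⟨h3, l, h4, h5⟩ := hC
      obtain ⟨h6, h7⟩ := mem_of_firstFree h4
      refine ⟨trueUnder_iff.2 ⟨l, h6, ?_⟩, h3⟩
      rw [PartialGuess.value_append_of_free h7]
      simpa using h5
    have h3 : 2 ^ N * wsum L (undecided P) (BitClause.wt i) ≤ 2 ^ (J[i]?.getD 0) *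
        (wsum L (undecided P) (fun C => e.1.scaled C i) + L.length) := by
      have h4 : wsum L (undecided P) (fun C => e.1.scaled C i + 1) ≤
          wsum L (undecided P) (fun C => e.1.scaled C i) + L.length := by
        rw [wsum_add]
        have := wsum_const_le (L := L) (p := undecided P) 1
        omega
      refine le_trans ?_ (Nat.mul_le_mul_left _ h4)
      rw [mul_wsum, mul_wsum]
      refine wsum_le_wsum fun C hC h => ⟨h, ?_⟩
      refine Guess.le_scaled_mul e.1 C i ?_
      simp only [undecided, Bool.and_eq_true, Bool.not_eq_true', Option.isSome_iff_exists] at h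
      obtain ⟨h5, l, h6⟩ := h
      obtain ⟨h7, h8⟩ := mem_of_firstFree h6
      rw [hPe] at h8
      -- The scaled weight of the clause is part of the load of its free literal, which is light; so
      -- no truncation took place.
      refine lt_of_le_of_lt ?_ (load_lt_of_isFree h8 (hL C hC l h7) hi)
      rw [Guess.load_eq]
      refine le_wsum (f := fun C => e.1.scaled C i) hC (openWith_iff.2 ⟨?_, h7⟩)
      by_contra h9
      rw [Bool.not_eq_false] at h9
      rw [satBy_mono hGP h9] at h5
      cases h5
    have h4 : wsum L (undecided P) (fun C => e.1.scaled C i) ≤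
        ∑ v ∈ Finset.range n, (e.gainAt (v, true) i + e.gainAt (v, false) i) :=
      undecided_le_sum hL _
    have h5 : ∑ v ∈ Finset.range n, e.gainAt (v, PartialGuess.value Q v) i ≤
        wsum L (gained P (PartialGuess.value Q)) fun C => e.1.scaled C i :=
      sum_openFirst_le _ _ _ _
    have h6 : 2 ^ (J[i]?.getD 0) * wsum L (gained P (PartialGuess.value Q))
        (fun C => e.1.scaled C i) ≤
        2 ^ N * wsum L (gained P (PartialGuess.value Q)) (BitClause.wt i) := by
      rw [mul_wsum, mul_wsum]
      exact wsum_le_wsum fun C _ h => ⟨h, Guess.scaled_mul_le e.1 C i⟩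
    have hJ := hJ hg0
    set j := J[i]?.getD 0
    -- Rounding costs `L.length ≤ N` units and balancing `k * N`; by `hJ` these `(k + 1) * N` units
    -- are worth at most `2 * (k + 1) * g`.
    have h7 : 2 ^ N * wsum L (undecided P) (BitClause.wt i) ≤
        2 ^ N * (2 * wsum L (gained P (PartialGuess.value Q)) (BitClause.wt i) +
          2 * (k + 1) * g) := by
      calc _ ≤ 2 ^ j * (wsum L (undecided P) (fun C => e.1.scaled C i) + L.length) := h3
        _ ≤ 2 ^ j * ((2 * wsum L (gained P (PartialGuess.value Q)) (fun C => e.1.scaled C i) +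
            k * N) + N) := Nat.mul_le_mul_left _ (by omega)
        _ = 2 * (2 ^ j * wsum L (gained P (PartialGuess.value Q)) (fun C => e.1.scaled C i)) +
            (k + 1) * (N * 2 ^ j) := by ring
        _ ≤ 2 * (2 ^ N * wsum L (gained P (PartialGuess.value Q)) (BitClause.wt i)) +
            (k + 1) * (2 * (g * 2 ^ N)) := by gcongr
        _ = _ := by ring
    have h8 := Nat.le_of_mul_le_mul_left h7 (by positivity)
    omega

/-- The greedy literals and the exponents fitted to them are among the enumerated guesses. For this
guess, the table realizes the gain vector of a balanced assignment, possibly by a different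
assignment. -/
theorem exists_mem_approx (k : ℕ) (hlen : L.length < N) (hL : ∀ C ∈ L, ∀ l ∈ C.1, l.1 < n)
    (hw : ∀ C ∈ L, ∀ i, C.wt i ≤ 2 ^ N) (I : ℕ → Bool) :
    ∃ u ∈ approx k (k * (2 * (k + 1))) (N, n, L), ∀ i < k,
      wsum L (trueUnder I) (BitClause.wt i) ≤
        2 * wsum L (trueUnder fun v => u[v]?.getD false) (BitClause.wt i) := by
  obtain ⟨G, hG1, hG2, hG3⟩ := exists_greedy L n I BitClause.wt (2 * (k + 1)) k
  choose! g hg1 hg2 using hG3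
  have hg3 : ∀ i < k, g i < N * 2 ^ N := by
    intro i hi
    have h1 : wsum L (satBy G) (BitClause.wt i) ≤ L.length * 2 ^ N :=
      (wsum_le_wsum (q := satBy G) fun C hC h => ⟨h, hw C hC i⟩).trans (wsum_const_le _)
    have h2 : g i ≤ 2 * (k + 1) * g i := Nat.le_mul_of_pos_left _ (by omega)
    have h3 : L.length * 2 ^ N < N * 2 ^ N := Nat.mul_lt_mul_of_pos_right hlen (by positivity)
    have := hg2 i hi
    omega
  have hex := fun i (hi : i < k) => exists_exponent (hg3 i hi)
  choose! j hj1 hj2 hj3 using hex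
  let J := (List.range k).map j
  have hJ : ∀ i < k, J[i]?.getD 0 = j i := fun i hi => by simp [J, hi]
  let e : Guess := ((N, n, L), G, J)
  -- Scaling rounds down, so for a literal true under `I` the load is at most `g i * 2 ^ N / 2 ^ j
  -- i`, which is below `N`.
  have hload : ∀ v < n, ∀ i < k, e.load (v, I v) i < N := by
    intro v hv i hi
    have h1 : 2 ^ (J[i]?.getD 0) * e.load (v, I v) i ≤
        2 ^ N * wsum L (openWith G (v, I v)) (BitClause.wt i) := by
      rw [Guess.load_eq, mul_wsum, mul_wsum]
      exact wsum_le_wsum fun C _ h => ⟨h, Guess.scaled_mul_le e C i⟩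
    rw [hJ i hi] at h1
    have h2 := Nat.mul_le_mul_left (2 ^ N) (hg1 i hi v hv)
    have h3 := hj2 i hi
    have h4 : 2 ^ j i * e.load (v, I v) i < 2 ^ j i * N := by linarith
    exact lt_of_mul_lt_mul_left h4 (Nat.zero_le _)
  let P := e.partialAssignment k
  have hP : IsTrueList n I P := isTrueList_partialAssignment (e := e) hG2 hload
  let d : PartialGuess := (e, P)
  obtain ⟨x, hx⟩ := exists_balanced_choice (k := k) (n := n) (N := N)
    (fun v b i => d.gainAt (v, b) i) fun v hv b i hi => by
      -- A free literal has a load below `N`; any other is never the first free literal of a clause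
      -- and has gain zero.
      by_cases hfree : isFree P (v, b) = true
      · refine le_trans ?_ (load_lt_of_isFree (e := e) hfree hv hi).le
        rw [Guess.load_eq]
        refine wsum_le_wsum fun C _ h => ⟨openWith_anti (subset_partialAssignment (k := k)) ?_,
            le_rfl⟩
        rw [openFirst_iff] at h
        exact openWith_iff.2 ⟨h.1, (mem_of_firstFree h.2).1⟩
      · have h1 : d.gainAt (v, b) i ≤ wsum L (fun _ => true) fun _ => 0 := by
          refine wsum_le_wsum fun C _ h => ?_
          rw [openFirst_iff] at h
          exact absurd (mem_of_firstFree h.2).2 hfree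
        have h2 := wsum_const_le (L := L) (p := fun _ => true) 0
        omega
  obtain ⟨Q, hQ1, hQ2⟩ := PartialGuess.exists_mem_table (k := k) (e := d) hlen x
  refine ⟨(List.range n).map (PartialGuess.value (P ++ Q)), ?_, fun i hi => ?_⟩
  · refine List.mem_flatMap.2 ⟨G, mem_litLists hG1 fun l hl => (hG2 l hl).1, ?_⟩
    refine List.mem_flatMap.2 ⟨J, mem_exponentLists (by simp [J]) fun a ha => ?_, ?_⟩
    · obtain ⟨i, hi, rfl⟩ := List.mem_map.1 ha
      exact hj1 i (by simpa using hi)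
    · exact List.mem_map.2 ⟨some Q, hQ1, rfl⟩
  · refine (trueUnder_le (g := g i) hi hlen hL rfl hP (hg1 i hi) (hg2 i hi) ?_ (hx i hi)
      (hQ2 i hi)).trans ?_
    · rw [hJ i hi]
      exact hj3 i hi
    · refine Nat.mul_le_mul_left _ (wsum_le_wsum fun C hC h => ⟨?_, le_rfl⟩)
      obtain ⟨l, h1, h2⟩ := trueUnder_iff.1 h
      refine trueUnder_iff.2 ⟨l, h1, ?_⟩
      simpa [hL C hC l h1] using h2

end guarantee

/-! ### Transfer to weighted formulas -/

theorem WeightedCNF.weight_eq {k : ℕ} (x : WeightedCNF k) (I : Fin x.numVars → Bool) (J : ℕ → Bool)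
    (h : ∀ v : Fin x.numVars, J v = I v) (i : Fin k) : x.weight I i =
      wsum (x.clauses.map WeightedClause.toBits) (trueUnder J) (BitClause.wt i) := by
  rw [← sum_filter_eq_wsum, WeightedCNF.weight, List.filter_map, List.map_map]
  have h1 : ∀ C : WeightedClause x.numVars k, trueUnder J C.toBits =
      decide (C.IsSatisfiedBy I) := by
    intro C
    rw [Bool.eq_iff_iff, trueUnder_iff, decide_eq_true_iff, WeightedClause.IsSatisfiedBy]
    simp only [WeightedClause.toBits, List.mem_map]
    constructor
    · rintro ⟨_, ⟨l, h2, rfl⟩, h3⟩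
      exact ⟨l, h2, by rw [← h]; exact h3⟩
    · rintro ⟨l, h2, h3⟩
      exact ⟨_, ⟨l, h2, rfl⟩, by rw [← h] at h3; exact h3⟩
  have h2 : (trueUnder J ∘ WeightedClause.toBits : WeightedClause x.numVars k → Bool) =
      fun C => decide (C.IsSatisfiedBy I) := funext h1
  rw [h2]
  congr 1
  refine List.map_congr_left fun C _ => ?_
  simp [BitClause.wt, WeightedClause.toBits, bitsVal_encodeNat]

theorem wt_toBits_le {k : ℕ} (x : WeightedCNF k) :
    ∀ C ∈ x.clauses.map WeightedClause.toBits, ∀ i, C.wt i ≤ 2 ^ (x.encode.length + 1) := by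
  intro C' hC' i
  obtain ⟨C, hC, rfl⟩ := List.mem_map.1 hC'
  by_cases hi : i < k
  · have h1 := x.weight_lt hC ⟨i, hi⟩
    have h2 : C.toBits.wt i = C.weight ⟨i, hi⟩ := by
      simp [BitClause.wt, WeightedClause.toBits, bitsVal_encodeNat, hi]
    rw [h2, pow_succ]
    omega
  · have h2 : C.toBits.wt i = 0 := by
      simp [BitClause.wt, WeightedClause.toBits, hi, bitsVal]
    rw [h2]
    exact Nat.zero_le _

/-- The algorithm on words. -/
def approxWords (k : ℕ) (l : List Symbol) : List (List Bool) :=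
  approx k (k * (2 * (k + 1))) (parse l)

theorem length_of_mem_approx {k r : ℕ} {x : BitCNF} {u : List Bool} (hu : u ∈ approx k r x) :
    u.length = x.2.1 := by
  obtain ⟨G, _, hu⟩ := List.mem_flatMap.1 hu
  obtain ⟨J, _, hu⟩ := List.mem_flatMap.1 hu
  obtain ⟨Q, _, rfl⟩ := List.mem_map.1 hu
  simp

open StackProgram in
theorem isApproximable_kMaxSAT (k : ℕ) : (kMaxSAT k).IsApproximable (1 / 2) := by
  refine ⟨fun x : WeightedCNF k => (approxWords k x.encode).map fun u v => u[v.1]?.getD false,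
    ?_, ?_⟩
  · have hF : PolyTime fun l => MaxProblem.encodeWords (approxWords k l) :=
      poly_encodeWords.comp ((poly_approx k _).comp poly_parse)
    refine hF.tm2ComputableInPolyTime fun x : WeightedCNF k => ?_
    -- All output words have length `numVars`, so reading them as truth assignments and encoding
    -- these again changes nothing.
    change MaxProblem.encodeWords (approxWords k x.encode) = MaxProblem.encodeWords
      (((approxWords k x.encode).map fun u (v : Fin x.numVars) => u[v.1]?.getD false).map
        fun I => List.ofFn I)
    congr 1
    rw [List.map_map]
    refine (List.map_id _).symm.trans (List.map_congr_left fun u hu => ?_)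
    have hlen := length_of_mem_approx hu
    rw [parse_encode] at hlen
    change u = List.ofFn fun v : Fin x.numVars => u[v.1]?.getD false
    refine List.ext_getElem (by simpa using hlen) fun v h1 h2 => ?_
    simp [h1]
  · intro (x : WeightedCNF k) (I : Fin x.numVars → Bool)
    obtain ⟨u, hu, h⟩ := exists_mem_approx (L := x.clauses.map WeightedClause.toBits)
      (n := x.numVars) (N := x.encode.length + 1) k
      (by have := x.length_clauses_le; simp; omega)
      (by
        intro C hC l hl
        obtain ⟨C, _, rfl⟩ := List.mem_map.1 hC
        obtain ⟨l, _, rfl⟩ := List.mem_map.1 hl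
        exact l.1.isLt)
      (wt_toBits_le x) (fun v => if h : v < x.numVars then I ⟨v, h⟩ else false)
    refine ⟨fun v => u[v.1]?.getD false, ?_, fun i => ?_⟩
    · refine List.mem_map.2 ⟨u, ?_, rfl⟩
      rw [approxWords, parse_encode]
      exact hu
    · have h1 := x.weight_eq I (fun v => if h : v < x.numVars then I ⟨v, h⟩ else false)
        (fun v => by simp) i
      have h2 := x.weight_eq (fun v => u[v.1]?.getD false) (fun v => u[v]?.getD false)
        (fun v => rfl) i
      have h3 := h i i.isLt
      rw [← h1, ← h2] at h3
      have h4 : ((x.weight I i : ℕ) : ℝ) ≤ 2 * (x.weight (fun v => u[v.1]?.getD false) i : ℕ) := by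
        exact_mod_cast h3
      change 1 / 2 * ((x.weight I i : ℕ) : ℝ) ≤ ((x.weight (fun v => u[v.1]?.getD false) i : ℕ) : ℝ)
      linarith

end MaxSAT

theorem mainTheorem2 (k : ℕ) (hk : 1 ≤ k) : (kMaxSAT k).IsApproximable (1 / 2) := by
  exact MaxSAT.isApproximable_kMaxSAT k
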